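/- Let $N\ge 1$ be an integer, $\zeta_N=e^{2\pi i/N}$, and let $\mathbb H$ be the upper half plane; for $\tau\in\mathbb H$ put $q=e^{2\pi i\tau}$. Hecke's series. For a lattice $L\subset\mathbb C$ and $u\in N^{-1}L$, the series $$\Phi(L,u,s)=\sum_{\omega\ne 0,\ \omega/N\equiv u \bmod L}\omega^{-1}|\omega|^{-s}$$ converges absolutely for $\operatorname{Re}s>1$ and continues analytically to a half plane $\operatorname{Re}s>c$ with $c<0$. Let $G(L,u)=\Phi(L,u,0)$ be the value at $s=0$ of this continuation, and let $G_{a,b}(\tau)=G(\mathbb Z\tau+\mathbb Z,(a\tau+b)/N)$ for $a,b\in\mathbb Z$ (this depends only on $a,b$ modulo $N$). For $k\in\mathbb Z$ let $$g_k(\tau)=\frac1i D_0(\zeta_N^k)-\sum_{n=1}^\infty\Bigl(\sum_{m\mid n,\ m>0}(\zeta_N^{km}-\zeta_N^{-km})\Bigr)q^n,$$ where $D_0(z)=\operatorname{Im}\frac{z}{1-z}$ for $z\neq1$ and $D_0(1)=0$; the series converges absolutely on $\mathbb H$. For a lattice $L$ and $u\in N^{-1}L$ let $$G'(L,u)=\sum_{w\in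 N^{-1}L/L}\chi^L_u(w)\,G(L,w),\qquad \chi^L_u(w)=\exp\Bigl(2\pi i N\,\frac{\operatorname{Re}u\operatorname{Im}w-\operatorname{Im}u\operatorname{Re}w}{\operatorname{covol}(L)}\Bigr).$$ If $N\ge 2$ and $u$ has order exactly $N$ modulo $L$, let $A_1(L,u)=\zeta(u;L)-\frac1N\eta(Nu;L)$ (Katz's modular form of weight one), where $\zeta(z;L)=\frac1z+\sum_{0\ne\omega\in L}\bigl(\frac1{z-\omega}+\frac1\omega+\frac z{\omega^2}\bigr)$ is the Weierstrass zeta function and $\eta(\omega;L)$, for $\omega\in L$, is its quasi-period: $\zeta(z+\omega;L)=\zeta(z;L)+\eta(\omega;L)$. **Proposition 3.2.** For every $k\in\mathbb Z$ and $\tau\in\mathbb H$, $$\frac1{2\pi i}\sum_{a,b \bmod N}\zeta_N^{ka}\,G_{a,b}(\tau)=g_k(\tau).$$ Moreover $g_k(\tau)=G'(2\pi i\mathbb Z+2\pi i\mathbb Z\tau,\ 2\pi i k/N)$, and $g_k$ is a holomorphic modular form (holomorphic on $\mathbb H$ and at all cusps) of weight one for $\Gamma_1(N)$. If $N\ge2$,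 then $A_1=G'$, that is, $A_1(L,u)=G'(L,u)$ for every lattice $L$ and every $u$ of order exactly $N$ modulo $L$. -/

import Mathlib

open Complex
open scoped UpperHalfPlane

namespace HeckeEisenstein

noncomputable section

/-- The root of unity `ζ_N = exp (2πi / N)`. -/
def zetaN (N : ℕ) : ℂ := cexp (2 * Real.pi * I / N)

/-- The imaginary part of the 0-logarithm `z / (1 - z)`, with value `0` at `z = 1`. -/
def D₀ (z : ℂ) : ℝ := if z = 1 then 0 else (z / (1 - z)).im

/-- The nome `q = exp (2πi τ)`. -/
def nome (τ : ℍ) : ℂ := cexp (2 * Real.pi * I * (τ : ℂ))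

/-- The `n`-th term (`n ≥ 1`) of the `q`-series in `g_k`, without its sign:
`(∑_{m ∣ n} (ζ_N^{km} - ζ_N^{-km})) q^n`. -/
def gTerm (N : ℕ) (k : ℤ) (τ : ℍ) (n : ℕ+) : ℂ :=
  (∑ m ∈ (n : ℕ).divisors, (zetaN N ^ (k * m) - zetaN N ^ (-(k * m)))) * nome τ ^ (n : ℕ)

/-- `g_k(τ) = (1/i) D₀(ζ_N^k) - ∑_{n ≥ 1} (∑_{m ∣ n} (ζ_N^{km} - ζ_N^{-km})) q^n`. -/
def g (N : ℕ) (k : ℤ) (τ : ℍ) : ℂ :=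
  1 / I * (D₀ (zetaN N ^ k) : ℂ) - ∑' n : ℕ+, gTerm N k τ n

/-- The numbers `ω` with `ω / N ≡ u mod L`. -/
def cosetSet (N : ℕ) (L : Submodule ℤ ℂ) (u : ℂ) : Set ℂ := {ω | ω / N - u ∈ L}

/-- The term `ω⁻¹ |ω|^{-s}` of Hecke's series, the term with `ω = 0` being omitted. -/
def heckeTerm (s ω : ℂ) : ℂ := if ω = 0 then 0 else ω⁻¹ * ((‖ω‖ : ℝ) : ℂ) ^ (-s)

/-- Hecke's series `Φ(L, u, s) = ∑' ω⁻¹ |ω|^{-s}` over the nonzero `ω` with `ω / N ≡ u mod L`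
(to be used for `Re s > 1`). -/
def heckePhi (N : ℕ) (L : Submodule ℤ ℂ) (u s : ℂ) : ℂ :=
  ∑' ω : cosetSet N L u, heckeTerm s ω

/-- `f` is an analytic continuation of `s ↦ Φ(L, u, s)` from `Re s > 1` to an open half-plane
`Re s > c` that contains `0`. -/
def IsHeckeContinuation (N : ℕ) (L : Submodule ℤ ℂ) (u : ℂ) (f : ℂ → ℂ) : Prop :=
  ∃ c : ℝ, c < 0 ∧ DifferentiableOn ℂ f {s | c < s.re} ∧
    ∀ s : ℂ, 1 < s.re → f s = heckePhi N L u s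

open Classical in
/-- `G(L, u) = Φ(L, u, 0)`, by analytic continuation. -/
def G (N : ℕ) (L : Submodule ℤ ℂ) (u : ℂ) : ℂ :=
  if h : ∃ f, IsHeckeContinuation N L u f then h.choose 0 else 0

/-- The Hecke weight-one Eisenstein series `G_{a,b}(τ) = G(ℤτ + ℤ, (aτ + b)/N)`. -/
def Gab (N : ℕ) (a b : ℤ) (τ : ℍ) : ℂ :=
  G N (Submodule.span ℤ {(τ : ℂ), 1}) ((a * (τ : ℂ) + b) / N)

/-- The coordinate of `u ∧ v` on the basis `1 ∧ i` of the exterior square of `ℂ` over `ℝ`. -/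
def wedge (u v : ℂ) : ℝ := u.re * v.im - u.im * v.re

/-- The character `χ^L_u(v) = exp (2πi N (u ∧ v) / α_L)`. The generator `α_L` of the exterior
square of `L` which is a positive multiple of `1 ∧ i` is `covolume L` times `1 ∧ i`. -/
def chi (N : ℕ) (L : Submodule ℤ ℂ) (u v : ℂ) : ℂ :=
  cexp (2 * Real.pi * I * N * ((wedge u v / ZLattice.covolume L : ℝ) : ℂ))

/-- `G'(L, u) = ∑_{w ∈ N⁻¹L/L} χ^L_u(w) G(L, w)`. The group `N⁻¹L/L` is the `N`-torsion
of `ℂ / L`, and each term depends only on the class `x` of `w` (when `u ∈ N⁻¹L`). -/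
def G' (N : ℕ) (L : Submodule ℤ ℂ) (u : ℂ) : ℂ :=
  ∑ᶠ x ∈ {x : ℂ ⧸ L | N • x = 0}, chi N L u x.out * G N L x.out

/-- The Weierstrass zeta function of the lattice `L`. -/
def weierstrassZeta (L : Submodule ℤ ℂ) (z : ℂ) : ℂ :=
  1 / z + ∑' ω : L, if ω = 0 then 0 else (1 / (z - ω) + 1 / (ω : ℂ) + z / (ω : ℂ) ^ 2)

open Classical in
/-- The quasi-period `η(ω)`, for `ω ∈ L`, of the Weierstrass zeta function:
the constant with `ζ(z + ω) = ζ(z) + η(ω)` for all `z ∉ L`. -/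
def quasiPeriod (L : Submodule ℤ ℂ) (ω : ℂ) : ℂ :=
  if h : ∃ c : ℂ, ∀ z ∉ L, weierstrassZeta L (z + ω) = weierstrassZeta L z + c
  then h.choose else 0

/-- Katz's modular form `A₁(L, u) = ζ(u) - η(N u) / N`, for `u` of order `N > 1` modulo `L`. -/
def A₁ (N : ℕ) (L : Submodule ℤ ℂ) (u : ℂ) : ℂ :=
  weierstrassZeta L u - quasiPeriod L (N * u) / N

end

end HeckeEisenstein

/-! Everything rests on Hecke's series twisted by a character `χ` of the lattice, `∑ χ(ω) ω⁻¹
|ω|^{-s}`. If `χ` is trivial the sum vanishes by oddness. If `χ ℓ ≠ 1`, summation by parts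
(`tsum_mul_heckeSecondDifference`) gives `2 - χ ℓ - χ (-ℓ)` times the sum as a sum of second
differences in the direction `ℓ`. These are `O(|ω|^{-3 - Re s})`, so the new sum is holomorphic for
`Re s > -1/2`. Fourier inversion on the `N`-torsion transfers the continuation to each coset, and
the finite Fourier transform `dualSum` of the values `G` is the twisted series at `s = 0`. There it
is given by an absolutely convergent sum (`mul_dualSum`), the working formula for all that follows.

For `ℤτ + ℤ` and a character of the coefficient of `τ` alone, take second differences in the
direction `τ` and sum each row `mτ + n` over `n`. The rows are differences of `π cot(π m τ)`, whose
`q`-expansion splits into a sign and a geometric series. The sign yields the constant term of `g_k`,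
and undoing the summation by parts on the rest yields its Lambert series (`dualSum_upperPair`).

Modularity comes from `G'` depending only on the lattice and the torsion point: `G'_latticePoint`
writes it as a `dualSum` for any negatively oriented pair of periods, so `SL(2, ℤ)` merely permutes
the dual sums up to the factor of automorphy. At the cusps it remains to bound every dual sum. When
the character is nontrivial on `1`, second differences in the direction `1` are dominated by `∑ |mτ
+ n|⁻³`, bounded for `Im τ ≥ 1`; otherwise the dual sum is a multiple of some `g_k`.

For Katz's form, sum the Weierstrass zeta function by rows. Periodicity of the cotangent identifies
the quasi-period of `1`; subtracting the linear term leaves a cotangent series whose value at `d/N`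
is `2πi g_d` (`weierstrassZeta_div_sub`). Any lattice with a nontrivial `N`-torsion point is a
multiple of `(ℤτ + ℤ, d/N)` (`exists_scalePair_lattice_eq`), so `A₁` and `G'` agree. -/

namespace HeckeEisenstein

open Filter Topology Finset

/-! ### The summand of Hecke's series and its second differences. -/

section HeckeTerm

lemma heckeTerm_zero_right (s : ℂ) : heckeTerm s 0 = 0 := by simp [heckeTerm]

lemma heckeTerm_of_ne_zero (s : ℂ) {ω : ℂ} (h : ω ≠ 0) :
    heckeTerm s ω = ω⁻¹ * ((‖ω‖ : ℝ) : ℂ) ^ (-s) := by simp [heckeTerm, h]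

lemma heckeTerm_zero_left (ω : ℂ) : heckeTerm 0 ω = ω⁻¹ := by
  by_cases h : ω = 0 <;> simp [heckeTerm, h]

lemma heckeTerm_mul (s a b : ℂ) : heckeTerm s (a * b) = heckeTerm s a * heckeTerm s b := by
  by_cases ha : a = 0
  · simp [heckeTerm, ha]
  by_cases hb : b = 0
  · simp [heckeTerm, hb]
  rw [heckeTerm_of_ne_zero s ha, heckeTerm_of_ne_zero s hb,
    heckeTerm_of_ne_zero s (mul_ne_zero ha hb), norm_mul, ofReal_mul,
    mul_cpow_ofReal_nonneg (norm_nonneg _) (norm_nonneg _), mul_inv]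
  ring

lemma heckeTerm_neg (s ω : ℂ) : heckeTerm s (-ω) = -heckeTerm s ω := by
  by_cases h : ω = 0
  · simp [heckeTerm, h]
  · rw [heckeTerm_of_ne_zero s h, heckeTerm_of_ne_zero s (neg_ne_zero.2 h), norm_neg, inv_neg,
      neg_mul]

lemma norm_heckeTerm (s : ℂ) {ω : ℂ} (h : ω ≠ 0) :
    ‖heckeTerm s ω‖ = ‖ω‖ ^ (-1 - s.re) := by
  have h0 : 0 < ‖ω‖ := norm_pos_iff.2 h
  rw [heckeTerm_of_ne_zero s h, norm_mul, norm_inv, norm_cpow_eq_rpow_re_of_pos h0,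
    Real.rpow_sub h0, Real.rpow_neg_one, neg_re, Real.rpow_neg h0.le, div_eq_mul_inv]

lemma differentiable_heckeTerm (ω : ℂ) : Differentiable ℂ fun s => heckeTerm s ω := by
  by_cases h : ω = 0
  · simp [heckeTerm, h]
  · simp only [heckeTerm, h, if_false]
    have : ((‖ω‖ : ℝ) : ℂ) ≠ 0 := by simpa using h
    exact (differentiable_neg.const_cpow (Or.inl this)).const_mul _

lemma heckeTerm_one_add (s : ℂ) {ε : ℂ} (h : 1 + ε ≠ 0) :
    heckeTerm s (1 + ε) = cexp (-log (1 + ε) - s * ((log (1 + ε)).re : ℂ)) := by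
  have h0 : ((‖1 + ε‖ : ℝ) : ℂ) ≠ 0 := by simpa using h
  rw [heckeTerm_of_ne_zero s h, cpow_def_of_ne_zero h0, sub_eq_add_neg, Complex.exp_add,
    Complex.exp_neg, exp_log h, log_re, ofReal_log (norm_nonneg _)]
  congr 2
  ring

/-- Writing the two values as `exp v` and `exp w`, the first-order parts of `v` and `w` cancel
because `log (1 + ε) + log (1 - ε) = O(ε²)`. The constant is `2 + 4 + 4`: the bound for `v + w`, and
one quadratic remainder for each exponential. -/
lemma norm_two_sub_heckeTerm_le {R : ℝ} (hR : 0 ≤ R) {s ε : ℂ} (hs : ‖s‖ ≤ R)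
    (hε : 2 * (1 + R) * ‖ε‖ ≤ 1) :
    ‖2 - heckeTerm s (1 + ε) - heckeTerm s (1 - ε)‖ ≤ 10 * (1 + R) ^ 2 * ‖ε‖ ^ 2 := by
  have hn := norm_nonneg ε
  have hε2 : ‖ε‖ ≤ 1 / 2 := by nlinarith
  have key : ∀ δ : ℂ, ‖δ‖ = ‖ε‖ →
      1 + δ ≠ 0 ∧ ‖log (1 + δ) - δ‖ ≤ ‖ε‖ ^ 2 ∧
      ‖-log (1 + δ) - s * ((log (1 + δ)).re : ℂ)‖ ≤ 2 * (1 + R) * ‖ε‖ := by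
    intro δ hδ
    refine ⟨fun h => ?_, ?_, ?_⟩
    · have : δ = -1 := by linear_combination h
      rw [this, norm_neg, norm_one] at hδ
      linarith
    · refine (norm_log_one_add_sub_self_le (by rw [hδ]; linarith)).trans ?_
      rw [hδ]
      have : (1 - ‖ε‖)⁻¹ ≤ 2 := by
        rw [inv_le_comm₀ (by linarith) (by norm_num)]
        linarith
      nlinarith [sq_nonneg ‖ε‖]
    · have h1 := norm_log_one_add_half_le_self (z := δ) (by rw [hδ]; linarith)
      rw [hδ] at h1
      have h2 : ‖((log (1 + δ)).re : ℂ)‖ ≤ ‖log (1 + δ)‖ := by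
        rw [norm_real]; exact abs_re_le_norm _
      calc _ ≤ ‖log (1 + δ)‖ + R * ‖log (1 + δ)‖ := by
            refine (norm_sub_le _ _).trans ?_
            rw [norm_neg, norm_mul]
            gcongr
        _ ≤ 2 * (1 + R) * ‖ε‖ := by nlinarith
  obtain ⟨hp0, hp1, hp2⟩ := key ε rfl
  obtain ⟨hm0, hm1, hm2⟩ := key (-ε) (norm_neg ε)
  rw [sub_eq_add_neg 1 ε, heckeTerm_one_add s hp0, heckeTerm_one_add s hm0]
  set a := log (1 + ε)
  set b := log (1 + -ε)
  have hab : ‖a + b‖ ≤ 2 * ‖ε‖ ^ 2 := by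
    have : a + b = (a - ε) + (b - -ε) := by ring
    rw [this]
    exact (norm_add_le _ _).trans (by linarith)
  set v := -a - s * (a.re : ℂ) with hv
  set w := -b - s * (b.re : ℂ) with hw
  have hvw : ‖v + w‖ ≤ (1 + R) * (2 * ‖ε‖ ^ 2) := by
    have : v + w = -(a + b) - s * ((a + b).re : ℂ) := by simp [hv, hw]; ring
    rw [this]
    refine (norm_sub_le _ _).trans ?_
    rw [norm_neg, norm_mul, norm_real]
    have := abs_re_le_norm (a + b)
    rw [← Real.norm_eq_abs] at this
    calc _ ≤ ‖a + b‖ + R * ‖a + b‖ := by gcongr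
      _ = (1 + R) * ‖a + b‖ := by ring
      _ ≤ _ := by gcongr
  have hv1 := norm_exp_sub_one_sub_id_le (hp2.trans hε)
  have hw1 := norm_exp_sub_one_sub_id_le (hm2.trans hε)
  have e : 2 - cexp v - cexp w = -(v + w) - (cexp v - 1 - v) - (cexp w - 1 - w) := by ring
  rw [e]
  refine (norm_sub_le _ _).trans ((add_le_add_left (norm_sub_le _ _) _).trans ?_)
  rw [norm_neg]
  have h3 : ‖v‖ ^ 2 ≤ (2 * (1 + R) * ‖ε‖) ^ 2 := by gcongr
  have h4 : ‖w‖ ^ 2 ≤ (2 * (1 + R) * ‖ε‖) ^ 2 := by gcongr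
  have h5 : (1 + R) * ‖ε‖ ^ 2 ≤ (1 + R) ^ 2 * ‖ε‖ ^ 2 := by
    gcongr; nlinarith
  nlinarith

lemma norm_heckeTerm_secondDifference_le {R : ℝ} (hR : 0 ≤ R) {s ω ℓ : ℂ} (hs : ‖s‖ ≤ R)
    (hω : ω ≠ 0) (hℓ : 2 * (1 + R) * ‖ℓ‖ ≤ ‖ω‖) :
    ‖2 * heckeTerm s ω - heckeTerm s (ω + ℓ) - heckeTerm s (ω - ℓ)‖ ≤
      10 * (1 + R) ^ 2 * ‖ℓ‖ ^ 2 * ‖ω‖ ^ (-3 - s.re) := by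
  have h0 : 0 < ‖ω‖ := norm_pos_iff.2 hω
  have e1 : ω + ℓ = ω * (1 + ℓ / ω) := by field_simp
  have e2 : ω - ℓ = ω * (1 - ℓ / ω) := by field_simp
  rw [e1, e2, heckeTerm_mul, heckeTerm_mul, show 2 * heckeTerm s ω
    - heckeTerm s ω * heckeTerm s (1 + ℓ / ω) - heckeTerm s ω * heckeTerm s (1 - ℓ / ω)
    = heckeTerm s ω * (2 - heckeTerm s (1 + ℓ / ω) - heckeTerm s (1 - ℓ / ω)) by ring,
    norm_mul, norm_heckeTerm s hω]
  have hb := norm_two_sub_heckeTerm_le hR hs (ε := ℓ / ω) (by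
    rw [norm_div, ← mul_div_assoc]; exact (div_le_one h0).2 hℓ)
  have e3 : ‖ω‖ ^ (-3 - s.re) = ‖ω‖ ^ (-1 - s.re) / ‖ω‖ ^ 2 := by
    rw [show -3 - s.re = (-1 - s.re) - 2 by ring, Real.rpow_sub h0]
    norm_num
  rw [e3]
  calc _ ≤ ‖ω‖ ^ (-1 - s.re) * (10 * (1 + R) ^ 2 * ‖ℓ / ω‖ ^ 2) := by gcongr
    _ = _ := by rw [norm_div]; ring

end HeckeTerm

/-! ### Continuation of series twisted by a unitary character. -/

section LatticeSum

/-- The lattice point with coordinates `x` with respect to a pair of periods. -/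
def latticePoint (P : PeriodPair) : ℤ × ℤ →+ ℂ where
  toFun x := x.1 * P.ω₁ + x.2 * P.ω₂
  map_zero' := by simp
  map_add' x y := by simp; ring

lemma latticePoint_apply (P : PeriodPair) (x : ℤ × ℤ) :
    latticePoint P x = x.1 * P.ω₁ + x.2 * P.ω₂ := rfl

lemma latticeEquivProd_symm_coe (P : PeriodPair) (x : ℤ × ℤ) :
    ((P.latticeEquivProd.symm x : P.lattice) : ℂ) = latticePoint P x :=
  P.latticeEquiv_symm_apply x

lemma latticePoint_injective (P : PeriodPair) : Function.Injective (latticePoint P) := by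
  intro x y h
  rw [← latticeEquivProd_symm_coe, ← latticeEquivProd_symm_coe] at h
  exact P.latticeEquivProd.symm.injective (Subtype.ext h)

lemma latticePoint_eq_zero {P : PeriodPair} {x : ℤ × ℤ} : latticePoint P x = 0 ↔ x = 0 :=
  map_eq_zero_iff _ (latticePoint_injective P)

lemma mem_lattice_iff_latticePoint {P : PeriodPair} {z : ℂ} :
    z ∈ P.lattice ↔ ∃ x, latticePoint P x = z := by
  rw [PeriodPair.mem_lattice]
  exact ⟨fun ⟨m, n, h⟩ => ⟨(m, n), h⟩, fun ⟨x, h⟩ => ⟨x.1, x.2, h⟩⟩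

lemma summable_norm_latticePoint_rpow (P : PeriodPair) {r : ℝ} (hr : r < -2) :
    Summable fun x => ‖latticePoint P x‖ ^ r := by
  have h := ZLattice.summable_norm_rpow P.lattice r (by simpa using hr)
  rw [← P.latticeEquivProd.symm.toEquiv.summable_iff] at h
  refine h.congr fun x => ?_
  simp only [Function.comp_apply, LinearEquiv.coe_toEquiv]
  rw [← latticeEquivProd_symm_coe]
  rfl

lemma finite_norm_latticePoint_lt (P : PeriodPair) (R : ℝ) :
    {x | ‖latticePoint P x‖ < R}.Finite := by
  have h := (summable_norm_latticePoint_rpow P (r := -3) (by norm_num)).tendsto_cofinite_zero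
  have hR : (0 : ℝ) < (max R 1) ^ (-3 : ℝ) := by positivity
  have h2 := h.eventually (gt_mem_nhds hR)
  rw [Filter.eventually_cofinite] at h2
  refine (h2.union (Set.finite_singleton 0)).subset fun x hx => ?_
  by_cases h0 : x = 0
  · right; exact h0
  · left
    have : 0 < ‖latticePoint P x‖ := norm_pos_iff.2 fun h => h0 (latticePoint_eq_zero.1 h)
    simp only [Set.mem_ofPred_eq, not_lt] at hx ⊢
    exact Real.rpow_le_rpow_of_nonpos this (hx.le.trans (le_max_left _ _)) (by norm_num)

lemma summable_heckeTerm_latticePoint (P : PeriodPair) {s : ℂ} (hs : 1 < s.re) :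
    Summable fun x => heckeTerm s (latticePoint P x) := by
  refine Summable.of_norm_bounded
    (summable_norm_latticePoint_rpow P (r := -1 - s.re) (by linarith)) fun x => ?_
  by_cases h : latticePoint P x = 0
  · rw [h, heckeTerm_zero_right, norm_zero]; positivity
  · rw [norm_heckeTerm s h]

/-- The second difference in the direction `ℓ` of the terms of Hecke's series. -/
noncomputable def heckeSecondDifference (P : PeriodPair) (s : ℂ) (ℓ x : ℤ × ℤ) : ℂ :=
  2 * heckeTerm s (latticePoint P x) - heckeTerm s (latticePoint P (x + ℓ))
    - heckeTerm s (latticePoint P (x - ℓ))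

/-- On bounded subsets of `Re s > -1/2` the second differences are dominated by a
summable family. -/
lemma exists_summable_bound_heckeSecondDifference (P : PeriodPair) (ℓ : ℤ × ℤ) {R : ℝ}
    (hR : 0 ≤ R) : ∃ u : ℤ × ℤ → ℝ, Summable u ∧ ∀ x s, ‖s‖ ≤ R → -(1 / 2) < s.re →
      ‖heckeSecondDifference P s ℓ x‖ ≤ u x := by
  have hB : ∀ x, ∃ B : ℝ, ∀ s ∈ Metric.closedBall (0 : ℂ) R,
      ‖heckeSecondDifference P s ℓ x‖ ≤ B := fun x =>
    (isCompact_closedBall (0 : ℂ) R).exists_bound_of_continuousOn (by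
      unfold heckeSecondDifference
      exact ((((differentiable_heckeTerm _).const_mul 2).sub (differentiable_heckeTerm _)).sub
        (differentiable_heckeTerm _)).continuous.continuousOn)
  choose B hB using hB
  -- Outside this radius the second-difference estimate applies, and `‖ω‖ ≥ 1` lets the exponent `-3
  -- - Re s` be replaced by `-5/2`. The finitely many points inside are bounded by compactness in
  -- `s`.
  set R' := max 1 (2 * (1 + R) * ‖latticePoint P ℓ‖) with hR'
  have hfin := finite_norm_latticePoint_lt P R'
  classical
  refine ⟨fun x => if ‖latticePoint P x‖ < R' then B x else
    10 * (1 + R) ^ 2 * ‖latticePoint P ℓ‖ ^ 2 * ‖latticePoint P x‖ ^ (-5 / 2 : ℝ), ?_, ?_⟩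
  · refine ((summable_norm_latticePoint_rpow P (r := -5 / 2) (by norm_num)).mul_left
      (10 * (1 + R) ^ 2 * ‖latticePoint P ℓ‖ ^ 2)).congr_cofinite ?_
    filter_upwards [hfin.compl_mem_cofinite] with x hx
    have : ¬ ‖latticePoint P x‖ < R' := hx
    simp [this]
  · intro x s hs hre
    by_cases hx : ‖latticePoint P x‖ < R'
    · simp only [hx, if_true]
      exact hB x s (by simpa using hs)
    · simp only [hx, if_false]
      push Not at hx
      have h1 : 1 ≤ ‖latticePoint P x‖ := (le_max_left _ _).trans hx
      have h0 : latticePoint P x ≠ 0 := norm_pos_iff.1 (by linarith)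
      unfold heckeSecondDifference
      rw [map_add, map_sub]
      refine (norm_heckeTerm_secondDifference_le hR hs h0 ((le_max_right _ _).trans hx)).trans ?_
      gcongr
      linarith

variable {χ : ℤ × ℤ → ℂ}

lemma summable_mul_heckeSecondDifference (P : PeriodPair) (ℓ : ℤ × ℤ) (h1 : ∀ x, ‖χ x‖ = 1)
    {s : ℂ} (hs : -(1 / 2) < s.re) : Summable fun x => χ x * heckeSecondDifference P s ℓ x := by
  obtain ⟨u, hu, hb⟩ := exists_summable_bound_heckeSecondDifference P ℓ (norm_nonneg s)
  refine Summable.of_norm_bounded hu fun x => ?_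
  rw [norm_mul, h1, one_mul]
  exact hb x s le_rfl hs

lemma differentiableOn_tsum_heckeSecondDifference (P : PeriodPair) (ℓ : ℤ × ℤ)
    (h1 : ∀ x, ‖χ x‖ = 1) :
    DifferentiableOn ℂ (fun s => ∑' x, χ x * heckeSecondDifference P s ℓ x)
      {s | -(1 / 2) < s.re} := by
  intro s hs
  obtain ⟨u, hu, hb⟩ := exists_summable_bound_heckeSecondDifference P ℓ
    (R := ‖s‖ + 1) (by positivity)
  have hopen : IsOpen ({s : ℂ | -(1 / 2) < s.re} ∩ {z | ‖z‖ < ‖s‖ + 1}) :=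
    (isOpen_lt continuous_const continuous_re).inter (isOpen_lt continuous_norm continuous_const)
  refine ((differentiableOn_tsum_of_summable_norm hu (fun x => ?_) hopen
    fun x w hw => ?_).differentiableAt (hopen.mem_nhds ⟨hs, ?_⟩)).differentiableWithinAt
  · unfold heckeSecondDifference
    exact (((((differentiable_heckeTerm _).const_mul 2).sub (differentiable_heckeTerm _)).sub
        (differentiable_heckeTerm _)).const_mul _).differentiableOn
  · rw [norm_mul, h1, one_mul]
    exact hb x w (le_of_lt hw.2) hw.1
  · simp

lemma tsum_mul_comp_add (hadd : ∀ x y, χ (x + y) = χ x * χ y) (f : ℤ × ℤ → ℂ) (ℓ : ℤ × ℤ) :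
    ∑' x, χ x * f (x + ℓ) = χ (-ℓ) * ∑' x, χ x * f x := by
  rw [← tsum_mul_left, ← (Equiv.addRight ℓ).tsum_eq (fun x => χ (-ℓ) * (χ x * f x))]
  refine tsum_congr fun x => ?_
  rw [Equiv.coe_addRight, ← mul_assoc, ← hadd, show -ℓ + (x + ℓ) = x by abel]

/-- Summation by parts. -/
lemma tsum_mul_heckeSecondDifference (P : PeriodPair) (ℓ : ℤ × ℤ) (h1 : ∀ x, ‖χ x‖ = 1)
    (hadd : ∀ x y, χ (x + y) = χ x * χ y) {s : ℂ} (hs : 1 < s.re) :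
    ∑' x, χ x * heckeSecondDifference P s ℓ x =
      (2 - χ ℓ - χ (-ℓ)) * ∑' x, χ x * heckeTerm s (latticePoint P x) := by
  have hsum : ∀ y, Summable fun x => χ x * heckeTerm s (latticePoint P (x + y)) := fun y => by
    refine Summable.of_norm ?_
    simp only [norm_mul, h1, one_mul]
    exact (((Equiv.addRight y).summable_iff).2 (summable_heckeTerm_latticePoint P hs)).norm
  have e : ∀ x, χ x * heckeSecondDifference P s ℓ x =
      2 * (χ x * heckeTerm s (latticePoint P (x + 0)))
        - χ x * heckeTerm s (latticePoint P (x + ℓ))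
        - χ x * heckeTerm s (latticePoint P (x + -ℓ)) := fun x => by
    rw [heckeSecondDifference, add_zero, ← sub_eq_add_neg]; ring
  simp_rw [e]
  rw [((hsum 0).mul_left 2 |>.sub (hsum ℓ)).tsum_sub (hsum (-ℓ)),
    ((hsum 0).mul_left 2).tsum_sub (hsum ℓ), tsum_mul_left,
    tsum_mul_comp_add hadd (fun x => heckeTerm s (latticePoint P x)) ℓ,
    tsum_mul_comp_add hadd (fun x => heckeTerm s (latticePoint P x)) (-ℓ), neg_neg]
  simp only [add_zero]
  ring

lemma tsum_heckeTerm_latticePoint (P : PeriodPair) (s : ℂ) :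
    ∑' x, heckeTerm s (latticePoint P x) = 0 := by
  have h := (Equiv.neg (ℤ × ℤ)).tsum_eq fun x => heckeTerm s (latticePoint P x)
  simp only [Equiv.neg_apply, map_neg, heckeTerm_neg, tsum_neg] at h
  exact self_eq_neg.1 h.symm

/-- Since `χ (-ℓ)` is the inverse of `χ ℓ`, the factor equals `-(χ ℓ - 1)² / χ ℓ`. -/
lemma two_sub_character_ne_zero (h1 : ∀ x, ‖χ x‖ = 1) (hadd : ∀ x y, χ (x + y) = χ x * χ y)
    {ℓ : ℤ × ℤ} (hℓ : χ ℓ ≠ 1) : 2 - χ ℓ - χ (-ℓ) ≠ 0 := by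
  have hmul : χ ℓ * χ (-ℓ) = 1 := by
    have h0 : χ 0 ≠ 0 := norm_pos_iff.1 (by rw [h1]; norm_num)
    rw [← hadd, add_neg_cancel]
    refine mul_left_cancel₀ h0 ?_
    rw [← hadd, add_zero, mul_one]
  intro h2
  have : (χ ℓ - 1) ^ 2 = 0 := by linear_combination (-χ ℓ) * h2 - hmul
  exact hℓ (sub_eq_zero.1 (pow_eq_zero_iff two_ne_zero |>.1 this))

/-- The continuation of `∑ χ(ω) ω⁻¹ |ω|^{-s}` for a unitary character `χ` of the lattice. -/
lemma exists_continuation_tsum_mul_heckeTerm (P : PeriodPair) (h1 : ∀ x, ‖χ x‖ = 1)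
    (hadd : ∀ x y, χ (x + y) = χ x * χ y) :
    ∃ F : ℂ → ℂ, DifferentiableOn ℂ F {s | -(1 / 2) < s.re} ∧
      ∀ s : ℂ, 1 < s.re → F s = ∑' x, χ x * heckeTerm s (latticePoint P x) := by
  by_cases h : ∀ ℓ, χ ℓ = 1
  · refine ⟨0, differentiableOn_const 0, fun s _ => ?_⟩
    simp [h, tsum_heckeTerm_latticePoint]
  · push Not at h
    obtain ⟨ℓ, hℓ⟩ := h
    have hne := two_sub_character_ne_zero h1 hadd hℓ
    refine ⟨fun s => (2 - χ ℓ - χ (-ℓ))⁻¹ * ∑' x, χ x * heckeSecondDifference P s ℓ x,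
      (differentiableOn_tsum_heckeSecondDifference P ℓ h1).const_mul _, fun s hs => ?_⟩
    simp only
    rw [tsum_mul_heckeSecondDifference P ℓ h1 hadd hs, inv_mul_cancel_left₀ hne]

end LatticeSum

/-! ### Uniqueness of the continuation at `s = 0`. -/

section Continuation

/-- The identity theorem on the smaller of the two half-planes. It makes `G` independent of the
chosen continuation and carries identities from the region of convergence to `s = 0`. -/
lemma eq_at_zero_of_eq_of_one_lt_re {f g : ℂ → ℂ} {c d : ℝ} (hc : c < 0) (hd : d < 0)
    (hf : DifferentiableOn ℂ f {s | c < s.re}) (hg : DifferentiableOn ℂ g {s | d < s.re})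
    (h : ∀ s : ℂ, 1 < s.re → f s = g s) : f 0 = g 0 := by
  set e := max c d
  have ho : IsOpen {s : ℂ | e < s.re} := isOpen_lt continuous_const continuous_re
  have hf' : AnalyticOnNhd ℂ f {s | e < s.re} :=
    (hf.mono fun s (hs : e < s.re) => (le_max_left c d).trans_lt hs).analyticOnNhd ho
  have hg' : AnalyticOnNhd ℂ g {s | e < s.re} :=
    (hg.mono fun s (hs : e < s.re) => (le_max_right c d).trans_lt hs).analyticOnNhd ho
  have he : e < 0 := max_lt hc hd
  refine hf'.eqOn_of_preconnected_of_eventuallyEq hg'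
    (convex_halfSpace_re_gt e).isPreconnected (z₀ := 2) (by simp; linarith) ?_ (by simpa using he)
  filter_upwards [(isOpen_lt continuous_const continuous_re : IsOpen {s : ℂ | (1 : ℝ) < s.re}).mem_nhds
    (by simp : (1 : ℝ) < (2 : ℂ).re)] with s hs using h s hs

lemma G_eq_of_isHeckeContinuation {N : ℕ} {L : Submodule ℤ ℂ} {u : ℂ} {f : ℂ → ℂ}
    (hf : IsHeckeContinuation N L u f) : G N L u = f 0 := by
  have h : ∃ f, IsHeckeContinuation N L u f := ⟨f, hf⟩
  rw [G, dif_pos h]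
  obtain ⟨c, hc, hc1, hc2⟩ := hf
  obtain ⟨d, hd, hd1, hd2⟩ := h.choose_spec
  exact eq_at_zero_of_eq_of_one_lt_re hd hc hd1 hc1 fun s hs => (hd2 s hs).trans (hc2 s hs).symm

end Continuation

/-! ### Characters of order dividing `N` and their orthogonality. -/

section TorsionChar

lemma isPrimitiveRoot_zetaN {N : ℕ} (hN : 0 < N) : IsPrimitiveRoot (zetaN N) N :=
  Complex.isPrimitiveRoot_exp N hN.ne'

lemma zetaN_ne_zero (N : ℕ) : zetaN N ≠ 0 := Complex.exp_ne_zero _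

lemma zetaN_zpow (N : ℕ) (m : ℤ) : zetaN N ^ m = cexp (2 * Real.pi * I * m / N) := by
  rw [zetaN, ← Complex.exp_int_mul]
  congr 1
  ring

lemma norm_zetaN (N : ℕ) : ‖zetaN N‖ = 1 := by
  rw [zetaN, show (2 * Real.pi * I / N : ℂ) = ((2 * Real.pi / N : ℝ) : ℂ) * I by push_cast; ring]
  exact norm_exp_ofReal_mul_I _

lemma norm_zetaN_zpow (N : ℕ) (m : ℤ) : ‖zetaN N ^ m‖ = 1 := by
  rw [norm_zpow, norm_zetaN, one_zpow]

lemma sum_range_zetaN_zpow {N : ℕ} (hN : 0 < N) (m : ℤ) :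
    ∑ i ∈ range N, zetaN N ^ ((i : ℤ) * m) = if (N : ℤ) ∣ m then (N : ℂ) else 0 := by
  have hp := isPrimitiveRoot_zetaN hN
  have e : ∀ i : ℕ, zetaN N ^ ((i : ℤ) * m) = (zetaN N ^ m) ^ i := fun i => by
    rw [mul_comm, zpow_mul, zpow_natCast]
  simp_rw [e]
  split_ifs with h
  · rw [(hp.zpow_eq_one_iff_dvd m).2 h]; simp
  · have h1 : zetaN N ^ m ≠ 1 := fun h2 => h ((hp.zpow_eq_one_iff_dvd m).1 h2)
    rw [geom_sum_eq h1, ← zpow_natCast, ← zpow_mul, mul_comm, zpow_mul, zpow_natCast, hp.pow_eq_one,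
      one_zpow, sub_self, zero_div]

/-- The character `(m, n) ↦ ζ_N^{km + ln}` of `ℤ × ℤ`. -/
noncomputable def torsionChar (N : ℕ) (k l : ℤ) (x : ℤ × ℤ) : ℂ := zetaN N ^ (k * x.1 + l * x.2)

lemma torsionChar_add (N : ℕ) (k l : ℤ) (x y : ℤ × ℤ) :
    torsionChar N k l (x + y) = torsionChar N k l x * torsionChar N k l y := by
  rw [torsionChar, torsionChar, torsionChar, ← zpow_add₀ (zetaN_ne_zero N)]
  congr 1
  simp only [Prod.fst_add, Prod.snd_add]
  ring

lemma norm_torsionChar (N : ℕ) (k l : ℤ) (x : ℤ × ℤ) : ‖torsionChar N k l x‖ = 1 :=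
  norm_zetaN_zpow N _

lemma sum_torsionChar_sub {N : ℕ} (hN : 0 < N) (x y : ℤ × ℤ) :
    ((N : ℂ) ^ 2)⁻¹ * ∑ i ∈ range N, ∑ j ∈ range N, torsionChar N i j (x - y) =
      if (N : ℤ) ∣ x.1 - y.1 ∧ (N : ℤ) ∣ x.2 - y.2 then 1 else 0 := by
  have hN' : (N : ℂ) ≠ 0 := by exact_mod_cast hN.ne'
  simp_rw [torsionChar, zpow_add₀ (zetaN_ne_zero N)]
  rw [← Finset.sum_mul_sum, Prod.fst_sub, Prod.snd_sub, sum_range_zetaN_zpow hN,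
    sum_range_zetaN_zpow hN]
  by_cases h1 : (N : ℤ) ∣ x.1 - y.1 <;> by_cases h2 : (N : ℤ) ∣ x.2 - y.2 <;> simp [h1, h2]
  field_simp

/-- Every class modulo `N` has a unique representative in `{0, …, N - 1}`. -/
lemma sum_range_ite_dvd_sub {N : ℕ} (hN : 0 < N) (m : ℤ) {M : Type*} [AddCommMonoid M]
    (f : ℤ → M) (hf : ∀ a b : ℤ, (N : ℤ) ∣ a - b → f a = f b) :
    ∑ a ∈ range N, (if (N : ℤ) ∣ m - a then f a else 0) = f m := by
  have hN' : (0 : ℤ) < N := by exact_mod_cast hN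
  have h0 := Int.emod_nonneg m hN'.ne'
  have h1 := Int.emod_lt_of_pos m hN'
  have hcast : ((m % N).toNat : ℤ) = m % N := Int.toNat_of_nonneg h0
  rw [Finset.sum_eq_single (m % N).toNat]
  · rw [hcast, if_pos (Int.dvd_self_sub_emod)]
    exact hf _ _ (by rw [← Int.dvd_neg, neg_sub]; exact Int.dvd_self_sub_emod)
  · intro b hb hne
    rw [if_neg]
    intro hd
    apply hne
    have : (b : ℤ) = m % N := by
      rw [← Int.emod_eq_of_lt (a := (b : ℤ)) (b := N) (by positivity)
        (by exact_mod_cast Finset.mem_range.1 hb)]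
      exact Int.modEq_iff_dvd.2 hd
    omega
  · intro h
    exact absurd (Finset.mem_range.2 (by omega)) h

end TorsionChar

/-! ### Coset sums, their continuation and their finite Fourier transform. -/

section CosetSums

variable {N : ℕ} (P : PeriodPair)

lemma mem_cosetSet_iff {P : PeriodPair} (hN : 0 < N) (y : ℤ × ℤ) (ω : ℂ) :
    ω ∈ cosetSet N P.lattice (latticePoint P y / N) ↔
      ∃ x, latticePoint P x = ω ∧ (N : ℤ) ∣ x.1 - y.1 ∧ (N : ℤ) ∣ x.2 - y.2 := by
  have hN' : (N : ℂ) ≠ 0 := by exact_mod_cast hN.ne'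
  rw [cosetSet, Set.mem_ofPred_eq, mem_lattice_iff_latticePoint]
  constructor
  · rintro ⟨z, hz⟩
    refine ⟨y + (N : ℤ) • z, ?_, by simp, by simp⟩
    rw [map_add, map_zsmul, hz, zsmul_eq_mul]
    push_cast
    field_simp
    ring
  · rintro ⟨x, rfl, ⟨c, hc⟩, ⟨d, hd⟩⟩
    refine ⟨(c, d), ?_⟩
    have hx : x = y + (N : ℤ) • (c, d) := by
      ext <;> simp
      · linear_combination hc
      · linear_combination hd
    rw [hx, map_add, map_zsmul, zsmul_eq_mul]
    push_cast
    field_simp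
    ring

lemma indicator_cosetSet_latticePoint (hN : 0 < N) (y x : ℤ × ℤ) (f : ℂ → ℂ) :
    (cosetSet N P.lattice (latticePoint P y / N)).indicator f (latticePoint P x) =
      (if (N : ℤ) ∣ x.1 - y.1 ∧ (N : ℤ) ∣ x.2 - y.2 then 1 else 0) * f (latticePoint P x) := by
  classical
  rw [Set.indicator_apply, mem_cosetSet_iff hN]
  have : (∃ x', latticePoint P x' = latticePoint P x ∧ (N : ℤ) ∣ x'.1 - y.1 ∧ (N : ℤ) ∣ x'.2 - y.2)
      ↔ ((N : ℤ) ∣ x.1 - y.1 ∧ (N : ℤ) ∣ x.2 - y.2) :=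
    ⟨fun ⟨x', h, h'⟩ => latticePoint_injective P h ▸ h', fun h => ⟨x, rfl, h⟩⟩
  simp only [this, ite_mul, one_mul, zero_mul]

lemma indicator_cosetSet_eq_zero (hN : 0 < N) (y : ℤ × ℤ) (f : ℂ → ℂ) (ω : ℂ)
    (hω : ω ∉ Set.range (latticePoint P)) :
    (cosetSet N P.lattice (latticePoint P y / N)).indicator f ω = 0 := by
  refine Set.indicator_of_notMem (fun h => hω ?_) f
  obtain ⟨x, hx, -⟩ := (mem_cosetSet_iff hN y ω).1 h
  exact ⟨x, hx⟩

lemma summable_heckeTerm_cosetSet (hN : 0 < N) (y : ℤ × ℤ) {s : ℂ} (hs : 1 < s.re) :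
    Summable fun ω : cosetSet N P.lattice (latticePoint P y / N) => heckeTerm s ω := by
  change Summable (heckeTerm s ∘ ((↑) : cosetSet N P.lattice (latticePoint P y / N) → ℂ))
  rw [summable_subtype_iff_indicator, ← (latticePoint_injective P).summable_iff
    (indicator_cosetSet_eq_zero P hN y _)]
  refine Summable.of_norm_bounded (summable_heckeTerm_latticePoint P hs).norm fun x => ?_
  rw [Function.comp_apply, indicator_cosetSet_latticePoint P hN, norm_mul]
  refine mul_le_of_le_one_left (norm_nonneg _) ?_
  split_ifs <;> simp

lemma heckePhi_latticePoint (hN : 0 < N) (y : ℤ × ℤ) (s : ℂ) :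
    heckePhi N P.lattice (latticePoint P y / N) s =
      ∑' x : ℤ × ℤ, (if (N : ℤ) ∣ x.1 - y.1 ∧ (N : ℤ) ∣ x.2 - y.2 then 1 else 0) *
        heckeTerm s (latticePoint P x) := by
  rw [heckePhi, tsum_subtype (cosetSet N P.lattice (latticePoint P y / N)) (heckeTerm s),
    ← (latticePoint_injective P).tsum_eq]
  · exact tsum_congr fun x => indicator_cosetSet_latticePoint P hN y x _
  · intro ω hω
    by_contra h
    exact hω (indicator_cosetSet_eq_zero P hN y _ ω h)

lemma summable_torsionChar_mul_heckeTerm (k l : ℤ) {s : ℂ} (hs : 1 < s.re) :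
    Summable fun x => torsionChar N k l x * heckeTerm s (latticePoint P x) := by
  refine Summable.of_norm ?_
  simp only [norm_mul, norm_torsionChar, one_mul]
  exact (summable_heckeTerm_latticePoint P hs).norm

/-- Hecke's series over a coset continues to `Re s > -1/2`. -/
lemma exists_heckeContinuation_latticePoint (hN : 0 < N) (y : ℤ × ℤ) :
    ∃ f, DifferentiableOn ℂ f {s | -(1 / 2) < s.re} ∧
      ∀ s : ℂ, 1 < s.re → f s = heckePhi N P.lattice (latticePoint P y / N) s := by
  choose F hF1 hF2 using fun i j : ℕ => exists_continuation_tsum_mul_heckeTerm P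
    (norm_torsionChar N i j) (torsionChar_add N i j)
  refine ⟨fun s => ((N : ℂ) ^ 2)⁻¹ * ∑ i ∈ range N, ∑ j ∈ range N,
    torsionChar N i j (-y) * F i j s, ?_, fun s hs => ?_⟩
  · exact (DifferentiableOn.fun_sum fun i _ => DifferentiableOn.fun_sum fun j _ =>
      (hF1 i j).const_mul _).const_mul _
  · rw [heckePhi_latticePoint P hN]
    -- Orthogonality expands the indicator of the coset in characters, reducing to the twisted
    -- series over the whole lattice.
    simp_rw [← sum_torsionChar_sub hN, mul_assoc, Finset.sum_mul]
    rw [tsum_mul_left]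
    congr 1
    have hsum : ∀ i j : ℕ, Summable fun x : ℤ × ℤ =>
        torsionChar N i j (x - y) * heckeTerm s (latticePoint P x) := fun i j => by
      refine ((summable_torsionChar_mul_heckeTerm (N := N) P i j hs).mul_right
        (torsionChar N i j (-y))).congr fun x => ?_
      rw [sub_eq_add_neg, torsionChar_add]
      ring
    rw [Summable.tsum_finsetSum fun i _ => summable_sum fun j _ => hsum i j]
    refine Finset.sum_congr rfl fun i _ => ?_
    rw [Summable.tsum_finsetSum fun j _ => hsum i j]
    refine Finset.sum_congr rfl fun j _ => ?_
    rw [hF2 i j s hs, ← tsum_mul_left]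
    refine tsum_congr fun x => ?_
    rw [sub_eq_add_neg, torsionChar_add]
    ring

lemma isHeckeContinuation_latticePoint (hN : 0 < N) (y : ℤ × ℤ) :
    ∃ f, IsHeckeContinuation N P.lattice (latticePoint P y / N) f :=
  let ⟨f, h1, h2⟩ := exists_heckeContinuation_latticePoint P hN y
  ⟨f, -(1 / 2), by norm_num, h1, h2⟩

/-- The finite Fourier transform of Hecke's series at `s = 0`. -/
noncomputable def dualSum (N : ℕ) (P : PeriodPair) (k l : ℤ) : ℂ :=
  ∑ a ∈ range N, ∑ b ∈ range N,
    torsionChar N k l (a, b) * G N P.lattice (latticePoint P (a, b) / N)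

/-- For `Re s > 1` the cosets partition the lattice and the character is constant on each, so the
weighted coset sums reassemble into one twisted sum. Uniqueness of continuation gives the equality
at `0`. -/
lemma dualSum_eq_of_continuation (hN : 0 < N) (k l : ℤ) {F : ℂ → ℂ} {c : ℝ} (hc : c < 0)
    (hF : DifferentiableOn ℂ F {s | c < s.re})
    (hF' : ∀ s : ℂ, 1 < s.re → F s = ∑' x, torsionChar N k l x * heckeTerm s (latticePoint P x)) :
    dualSum N P k l = F 0 := by
  choose f hf1 hf2 using exists_heckeContinuation_latticePoint P hN
  have hG : ∀ y, G N P.lattice (latticePoint P y / N) = f y 0 := fun y =>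
    G_eq_of_isHeckeContinuation ⟨-(1 / 2), by norm_num, hf1 y, hf2 y⟩
  simp_rw [dualSum, hG]
  refine eq_at_zero_of_eq_of_one_lt_re (f := fun s => ∑ a ∈ range N, ∑ b ∈ range N,
    torsionChar N k l (a, b) * f (a, b) s) (c := -(1 / 2)) (by norm_num) hc
    (DifferentiableOn.fun_sum fun i _ => DifferentiableOn.fun_sum fun j _ =>
      (hf1 _).const_mul _) hF fun s hs => ?_
  rw [hF' s hs]
  simp only [hf2 _ s hs, heckePhi_latticePoint P hN, ← tsum_mul_left]
  have hsum : ∀ a b : ℕ, Summable fun x : ℤ × ℤ => torsionChar N k l (a, b) *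
      ((if (N : ℤ) ∣ x.1 - a ∧ (N : ℤ) ∣ x.2 - b then 1 else 0) *
        heckeTerm s (latticePoint P x)) := fun a b => by
    refine Summable.mul_left _ (Summable.of_norm_bounded
      (summable_heckeTerm_latticePoint P hs).norm fun x => ?_)
    rw [norm_mul]
    refine mul_le_of_le_one_left (norm_nonneg _) ?_
    split_ifs <;> simp
  simp_rw [← Summable.tsum_finsetSum fun (b : ℕ) (_ : b ∈ range N) => hsum _ b]
  rw [← Summable.tsum_finsetSum fun a _ => summable_sum fun b _ => hsum a b]
  refine tsum_congr fun x => ?_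
  have hper : ∀ k a b : ℤ, (N : ℤ) ∣ a - b → zetaN N ^ (k * a) = zetaN N ^ (k * b) := by
    rintro k a b ⟨c, hc⟩
    rw [show k * a = k * b + N * (k * c) by linear_combination k * hc,
      zpow_add₀ (zetaN_ne_zero N), zpow_mul _ (N : ℤ), zpow_natCast,
      (isPrimitiveRoot_zetaN hN).pow_eq_one, one_zpow, mul_one]
  have e : ∀ a b : ℕ, torsionChar N k l (a, b) *
      ((if (N : ℤ) ∣ x.1 - a ∧ (N : ℤ) ∣ x.2 - b then 1 else 0) * heckeTerm s (latticePoint P x))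
      = ((if (N : ℤ) ∣ x.1 - a then zetaN N ^ (k * (a : ℤ)) else 0) *
        (if (N : ℤ) ∣ x.2 - b then zetaN N ^ (l * (b : ℤ)) else 0)) *
        heckeTerm s (latticePoint P x) := fun a b => by
    rw [torsionChar, zpow_add₀ (zetaN_ne_zero N)]
    by_cases h1 : (N : ℤ) ∣ x.1 - a <;> by_cases h2 : (N : ℤ) ∣ x.2 - b <;> simp [h1, h2]
  simp_rw [e, ← Finset.sum_mul]
  rw [← Finset.sum_mul_sum, sum_range_ite_dvd_sub hN x.1 (fun a => zetaN N ^ (k * a)) (hper k),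
    sum_range_ite_dvd_sub hN x.2 (fun b => zetaN N ^ (l * b)) (hper l), torsionChar,
    zpow_add₀ (zetaN_ne_zero N)]

/-- The values at `s = 0` are computed by summation by parts. -/
lemma mul_dualSum (hN : 0 < N) (k l : ℤ) (ℓ : ℤ × ℤ) :
    (2 - torsionChar N k l ℓ - torsionChar N k l (-ℓ)) * dualSum N P k l =
      ∑' x, torsionChar N k l x * heckeSecondDifference P 0 ℓ x := by
  obtain ⟨F, hF1, hF2⟩ := exists_continuation_tsum_mul_heckeTerm P
    (norm_torsionChar N k l) (torsionChar_add N k l)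
  rw [dualSum_eq_of_continuation P hN k l (by norm_num) hF1 hF2]
  refine eq_at_zero_of_eq_of_one_lt_re
    (f := fun s => (2 - torsionChar N k l ℓ - torsionChar N k l (-ℓ)) * F s)
    (c := -(1 / 2)) (d := -(1 / 2)) (by norm_num) (by norm_num) (hF1.const_mul _)
    (differentiableOn_tsum_heckeSecondDifference P ℓ (norm_torsionChar N k l)) fun s hs => ?_
  rw [tsum_mul_heckeSecondDifference P ℓ (norm_torsionChar N k l) (torsionChar_add N k l) hs,
    hF2 s hs]

lemma dualSum_eq_zero (hN : 0 < N) {k l : ℤ} (h : ∀ x, torsionChar N k l x = 1) :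
    dualSum N P k l = 0 :=
  dualSum_eq_of_continuation P hN k l (F := 0) (c := -1) (by norm_num) (differentiableOn_const 0)
    fun s _ => by simp [h, tsum_heckeTerm_latticePoint]

end CosetSums

/-! ### The pairing on torsion points, and `G'` as a dual sum. -/

section DualLattice

lemma wedge_add_right (u v w : ℂ) : wedge u (v + w) = wedge u v + wedge u w := by
  simp [wedge]; ring

lemma covolume_lattice (P : PeriodPair) :
    ZLattice.covolume P.lattice = |wedge P.ω₁ P.ω₂| := by
  rw [ZLattice.covolume_eq_det_mul_measureReal P.lattice MeasureTheory.volume P.latticeBasis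
    Complex.orthonormalBasisOneI.toBasis]
  have h1 : (MeasureTheory.volume : MeasureTheory.Measure ℂ).real
      (ZSpan.fundamentalDomain Complex.orthonormalBasisOneI.toBasis) = 1 := by
    rw [MeasureTheory.measureReal_congr
      (ZSpan.fundamentalDomain_ae_parallelepiped _ MeasureTheory.volume), MeasureTheory.measureReal_def]
    have := Complex.orthonormalBasisOneI.volume_parallelepiped
    simp only [OrthonormalBasis.coe_toBasis]
    rw [this]; rfl
  rw [h1, mul_one]
  congr 1
  rw [Module.Basis.det_apply, Matrix.det_fin_two]
  simp [Module.Basis.toMatrix_apply, wedge]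
  ring

lemma wedge_ne_zero (P : PeriodPair) : wedge P.ω₁ P.ω₂ ≠ 0 := by
  have h := ZLattice.covolume_ne_zero P.lattice MeasureTheory.volume
  rw [covolume_lattice] at h
  exact abs_ne_zero.1 h

lemma wedge_latticePoint_div (P : PeriodPair) (y x : ℤ × ℤ) (c : ℝ) :
    wedge (latticePoint P y / c) (latticePoint P x) =
      (y.1 * x.2 - y.2 * x.1) * wedge P.ω₁ P.ω₂ / c := by
  rw [wedge, wedge, latticePoint_apply, latticePoint_apply, div_ofReal_re, div_ofReal_im]
  simp
  ring

lemma wedge_div_right (u v : ℂ) (c : ℝ) : wedge u (v / c) = wedge u v / c := by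
  rw [wedge, wedge, div_ofReal_re, div_ofReal_im]; ring

variable {N : ℕ}

/-- The covolume is `|wedge ω₁ ω₂|`, so the orientation fixes the sign of the exponent. The negative
one is that of `(τ, 1)`. -/
lemma chi_latticePoint (hN : 0 < N) (P : PeriodPair) (hP : wedge P.ω₁ P.ω₂ < 0) (y x : ℤ × ℤ) :
    chi N P.lattice (latticePoint P y / N) (latticePoint P x / N) =
      torsionChar N y.2 (-y.1) x := by
  have hN' : (N : ℝ) ≠ 0 := by exact_mod_cast hN.ne'
  have hN'' : (N : ℂ) ≠ 0 := by exact_mod_cast hN.ne'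
  rw [chi, torsionChar, zetaN_zpow, covolume_lattice, abs_of_neg hP]
  have h1 := wedge_latticePoint_div P y x N
  have h2 := wedge_div_right (latticePoint P y / (N : ℝ)) (latticePoint P x) N
  rw [h1] at h2
  simp only [ofReal_natCast] at h2
  rw [h2]
  have e : (y.1 * x.2 - y.2 * x.1) * wedge P.ω₁ P.ω₂ / N / N / -wedge P.ω₁ P.ω₂ =
      (y.2 * x.1 - y.1 * x.2) / N / N := by
    field_simp [hP.ne]
    ring
  rw [e]
  congr 1
  push_cast
  field_simp
  ring

lemma chi_add_lattice (hN : 0 < N) (P : PeriodPair) (y : ℤ × ℤ) (w : ℂ) {ℓ : ℂ}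
    (hℓ : ℓ ∈ P.lattice) : chi N P.lattice (latticePoint P y / N) (w + ℓ) =
      chi N P.lattice (latticePoint P y / N) w := by
  have hN' : (N : ℝ) ≠ 0 := by exact_mod_cast hN.ne'
  obtain ⟨x, rfl⟩ := mem_lattice_iff_latticePoint.1 hℓ
  have h1 := wedge_latticePoint_div P y x N
  simp only [ofReal_natCast] at h1
  have hw := wedge_ne_zero P
  obtain ⟨n, hn⟩ : ∃ n : ℤ, N * (wedge (latticePoint P y / N) (latticePoint P x) /
      ZLattice.covolume P.lattice) = n := by
    rw [h1, covolume_lattice]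
    rcases hw.lt_or_gt with h | h
    · refine ⟨-(y.1 * x.2 - y.2 * x.1), ?_⟩
      rw [abs_of_neg h]
      push_cast
      field_simp
    · refine ⟨y.1 * x.2 - y.2 * x.1, ?_⟩
      rw [abs_of_pos h]
      push_cast
      field_simp
  rw [chi, chi, wedge_add_right, add_div, ofReal_add, mul_add, Complex.exp_add]
  rw [mul_right_eq_self₀]
  left
  rw [Complex.exp_eq_one_iff]
  refine ⟨n, ?_⟩
  have hn' := congrArg (fun r : ℝ => (r : ℂ)) hn
  simp only [ofReal_mul, ofReal_natCast, ofReal_intCast] at hn'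
  linear_combination (2 * Real.pi * I) * hn'

lemma G_eq_of_cosetSet_eq {L : Submodule ℤ ℂ} {u v : ℂ} (h : cosetSet N L u = cosetSet N L v) :
    G N L u = G N L v := by
  have h1 : heckePhi N L u = heckePhi N L v := by
    funext s
    rw [heckePhi, heckePhi, h]
  have h2 : IsHeckeContinuation N L u = IsHeckeContinuation N L v := by
    funext f
    simp only [IsHeckeContinuation, h1]
  unfold G
  rw [h2]

lemma G_add_lattice (N : ℕ) {L : Submodule ℤ ℂ} (w : ℂ) {ℓ : ℂ} (hℓ : ℓ ∈ L) :
    G N L (w + ℓ) = G N L w := by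
  apply G_eq_of_cosetSet_eq
  ext ω
  simp only [cosetSet, Set.mem_ofPred_eq]
  rw [← sub_sub]
  exact ⟨fun h => by simpa using L.add_mem h hℓ, fun h => L.sub_mem h hℓ⟩

lemma bijOn_torsion (hN : 0 < N) (P : PeriodPair) :
    Set.BijOn (fun x : ℕ × ℕ =>
        (Submodule.Quotient.mk (latticePoint P (x.1, x.2) / N) : ℂ ⧸ P.lattice))
      (range N ×ˢ range N : Finset (ℕ × ℕ)) {x | N • x = 0} := by
  have hN' : (N : ℂ) ≠ 0 := by exact_mod_cast hN.ne'
  have hN0 : (0 : ℤ) < N := by exact_mod_cast hN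
  refine ⟨fun x _ => ?_, fun x hx y hy h => ?_, fun q hq => ?_⟩
  · rw [Set.mem_ofPred_eq, ← Submodule.Quotient.mk_smul, Submodule.Quotient.mk_eq_zero, nsmul_eq_mul,
      mul_div_cancel₀ _ hN', mem_lattice_iff_latticePoint]
    exact ⟨_, rfl⟩
  · simp only [Finset.coe_product, Set.mem_prod, Finset.mem_coe, Finset.mem_range] at hx hy
    rw [Submodule.Quotient.eq] at h
    obtain ⟨z, hz⟩ := mem_lattice_iff_latticePoint.1 h
    have : latticePoint P ((N : ℤ) • z) = latticePoint P (((x.1 : ℤ), (x.2 : ℤ)) - ((y.1 : ℤ), (y.2 : ℤ))) := by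
      rw [map_zsmul, map_sub, hz, zsmul_eq_mul]
      push_cast
      field_simp
    have h2 := latticePoint_injective P this
    have h3 : (N : ℤ) ∣ x.1 - y.1 := ⟨z.1, by simpa using (congrArg Prod.fst h2).symm⟩
    have h4 : (N : ℤ) ∣ x.2 - y.2 := ⟨z.2, by simpa using (congrArg Prod.snd h2).symm⟩
    have key : ∀ a b : ℕ, a < N → b < N → (N : ℤ) ∣ a - b → a = b := fun a b ha hb hd => by
      have := Int.eq_zero_of_abs_lt_dvd hd (by rw [abs_lt]; omega)
      omega
    exact Prod.ext (key _ _ hx.1 hy.1 h3) (key _ _ hx.2 hy.2 h4)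
  · obtain ⟨w, rfl⟩ := Submodule.Quotient.mk_surjective _ q
    rw [Set.mem_ofPred_eq, ← Submodule.Quotient.mk_smul, Submodule.Quotient.mk_eq_zero,
      nsmul_eq_mul, mem_lattice_iff_latticePoint] at hq
    obtain ⟨x, hx⟩ := hq
    refine ⟨((x.1 % N).toNat, (x.2 % N).toNat), ?_, ?_⟩
    · have h1 := Int.emod_lt_of_pos x.1 hN0
      have h2 := Int.emod_lt_of_pos x.2 hN0
      simp only [Finset.coe_product, Set.mem_prod, Finset.mem_coe, Finset.mem_range]
      omega
    · simp only
      rw [Int.toNat_of_nonneg (Int.emod_nonneg _ hN0.ne'),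
        Int.toNat_of_nonneg (Int.emod_nonneg _ hN0.ne'), Submodule.Quotient.eq,
        mem_lattice_iff_latticePoint]
      refine ⟨-(x.1 / N, x.2 / N), ?_⟩
      have hw : w = latticePoint P x / N := by rw [hx]; field_simp
      have h3 : (x.1 % N, x.2 % N) = x - (N : ℤ) • (x.1 / (N : ℤ), x.2 / (N : ℤ)) := by
        ext <;> simp [Int.emod_def]
      rw [hw, h3, map_sub, map_zsmul, map_neg, zsmul_eq_mul]
      push_cast
      field_simp
      ring

/-- Both factors of a summand are invariant under translation by the lattice, so the representatives
`x.out` may be replaced by the points with coordinates in `{0, …, N - 1}`. The left side does not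
see the pair of periods; this is the source of modularity. -/
lemma G'_latticePoint (hN : 0 < N) (P : PeriodPair) (hP : wedge P.ω₁ P.ω₂ < 0) (y : ℤ × ℤ) :
    G' N P.lattice (latticePoint P y / N) = dualSum N P y.2 (-y.1) := by
  rw [G', dualSum, ← Finset.sum_product', ← finsum_mem_coe_finset]
  refine (finsum_mem_eq_of_bijOn _ (bijOn_torsion hN P) fun x _ => ?_).symm
  set q : ℂ ⧸ P.lattice := Submodule.Quotient.mk (latticePoint P (x.1, x.2) / N) with hq
  have hmem : q.out - latticePoint P (x.1, x.2) / N ∈ P.lattice := by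
    rw [← Submodule.Quotient.eq, ← hq]
    exact Quotient.out_eq q
  have hout : q.out = latticePoint P (x.1, x.2) / N + (q.out - latticePoint P (x.1, x.2) / N) := by
    ring
  rw [hout, chi_add_lattice hN P y _ hmem, G_add_lattice N _ hmem, chi_latticePoint hN P hP]

end DualLattice

/-! ### Row sums and the cotangent. -/

section Cotangent

/-- Symmetric partial sums let an absolutely convergent row be split into pieces that converge only
conditionally. -/
lemma tendsto_sum_Icc_of_summable {f : ℤ → ℂ} (hf : Summable f) :
    Tendsto (fun M : ℕ => ∑ n ∈ Icc (-(M : ℤ)) M, f n) atTop (𝓝 (∑' n, f n)) := by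
  have h : HasSum f (∑' n, f n) (SummationFilter.symmetricIcc ℤ) :=
    hf.hasSum.mono_left (SummationFilter.LeAtTop.le_atTop)
  exact SummationFilter.hasSum_symmetricIcc_iff.1 h

lemma tendsto_sum_Icc_inv_add {w : ℂ} (hw : w ∈ integerComplement) :
    Tendsto (fun M : ℕ => ∑ n ∈ Icc (-(M : ℤ)) M, (w + n)⁻¹) atTop
      (𝓝 (Real.pi * cot (Real.pi * w))) := by
  have h := (tendsto_logDeriv_euler_cot_sub hw).const_add (1 / w)
  rw [add_sub_cancel] at h
  refine h.congr fun M => ?_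
  induction M with
  | zero => simp
  | succ M ih =>
    have h1 := sum_Icc_succ_eq_add_endpoints (fun n : ℤ => (w + n)⁻¹) (N := M)
    push_cast at h1 ⊢
    rw [h1, ← ih, Finset.sum_range_succ, cotTerm]
    ring

lemma sum_Icc_inv_eq_zero (M : ℕ) : ∑ n ∈ Icc (-(M : ℤ)) M, ((0 : ℂ) + n)⁻¹ = 0 := by
  induction M with
  | zero => simp
  | succ M ih =>
    have h1 := sum_Icc_succ_eq_add_endpoints (fun n : ℤ => ((0 : ℂ) + n)⁻¹) (N := M)
    push_cast at h1 ih ⊢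
    rw [h1, ih, add_zero, zero_add, zero_add, inv_neg, add_neg_cancel]

lemma pi_mul_cot_pi_eq_tsum_pnat {z : ℂ} (hz : 0 < z.im) :
    Real.pi * cot (Real.pi * z) =
      -(Real.pi * I) - 2 * Real.pi * I * ∑' n : ℕ+, cexp (2 * Real.pi * I * z) ^ (n : ℕ) := by
  obtain ⟨τ, rfl⟩ : ∃ τ : ℍ, (τ : ℂ) = z := ⟨⟨z, hz⟩, rfl⟩
  have hs := summable_geometric_of_norm_lt_one (UpperHalfPlane.norm_exp_two_pi_I_lt_one τ)
  rw [pi_mul_cot_pi_q_exp, ← tsum_zero_pnat_eq_tsum_nat hs, pow_zero]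
  generalize ∑' n : ℕ+, cexp (2 * Real.pi * I * τ) ^ (n : ℕ) = S
  ring

lemma cot_neg (z : ℂ) : cot (-z) = -cot z := by
  rw [cot, cot, Complex.cos_neg, Complex.sin_neg, div_neg]

end Cotangent

/-! ### Lambert series for `g_k`. -/

section Lambert

variable (τ : ℍ)

lemma norm_nome_lt_one : ‖nome τ‖ < 1 := UpperHalfPlane.norm_exp_two_pi_I_lt_one τ

/-- The geometric sums `∑_{n ≥ 1} q^{mn}`, made odd in `m`. -/
noncomputable def oddGeometric (m : ℤ) : ℂ :=
  (m.sign : ℂ) * ∑' n : ℕ+, nome τ ^ (m.natAbs * n)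

lemma oddGeometric_neg (m : ℤ) : oddGeometric τ (-m) = -oddGeometric τ m := by
  simp [oddGeometric, Int.sign_neg]

lemma oddGeometric_zero : oddGeometric τ 0 = 0 := by simp [oddGeometric]

lemma oddGeometric_pnat (m : ℕ+) : oddGeometric τ m = ∑' n : ℕ+, nome τ ^ ((m : ℕ) * n) := by
  have : (m : ℤ).sign = 1 := Int.sign_eq_one_of_pos (by exact_mod_cast m.pos)
  simp [oddGeometric, this]

/-- The `q`-expansion of the cotangent for `m > 0`, extended by oddness. At `m = 0` both sides
vanish, since `cot 0 = 0` by the convention for division by zero. -/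
lemma pi_mul_cot_int_mul (m : ℤ) : Real.pi * cot (Real.pi * (m * τ)) =
    -(Real.pi * I) * (m.sign + 2 * oddGeometric τ m) := by
  have key : ∀ m : ℕ+, Real.pi * cot (Real.pi * (((m : ℤ) : ℂ) * τ)) =
      -(Real.pi * I) * ((m : ℤ).sign + 2 * oddGeometric τ m) := fun m => by
    have hs : (m : ℤ).sign = 1 := Int.sign_eq_one_of_pos (by exact_mod_cast m.pos)
    have e : ∀ n : ℕ+, cexp (2 * Real.pi * I * (((m : ℤ) : ℂ) * τ)) ^ (n : ℕ) =
        nome τ ^ ((m : ℕ) * n) := fun n => by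
      rw [pow_mul, nome, ← Complex.exp_nat_mul (2 * Real.pi * I * τ)]
      congr 2
      push_cast
      ring
    rw [pi_mul_cot_pi_eq_tsum_pnat, oddGeometric_pnat, hs, tsum_congr e]
    · push_cast
      ring
    · have := τ.im_pos
      have hm : (0 : ℝ) < m := by exact_mod_cast m.pos
      simpa using mul_pos hm this
  rcases lt_trichotomy m 0 with h | rfl | h
  · have := key ⟨m.natAbs, by omega⟩
    simp only [PNat.mk_coe, Int.ofNat_natAbs_of_nonpos h.le, Int.sign_neg, oddGeometric_neg] at this
    push_cast at this
    rw [neg_mul, mul_neg, cot_neg] at this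
    linear_combination -this
  · simp [oddGeometric_zero, cot]
  · have := key ⟨m.natAbs, by omega⟩
    simpa only [PNat.mk_coe, Int.natAbs_of_nonneg h.le] using this

lemma summable_nome_pow_mul : Summable fun c : ℕ+ × ℕ+ => nome τ ^ ((c.1 : ℕ) * c.2) := by
  simpa using summable_prod_mul_pow 0 (norm_nome_lt_one τ)

lemma summable_oddGeometric : Summable (oddGeometric τ) := by
  have h : Summable fun m : ℕ => oddGeometric τ m := by
    rw [← summable_pnat_iff_summable_nat]
    have := (summable_nome_pow_mul τ).prod
    refine this.congr fun m => ?_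
    rw [← oddGeometric_pnat]
  refine Summable.of_nat_of_neg h ?_
  simp_rw [oddGeometric_neg]
  exact h.neg

lemma norm_le_two_of_sub_zpow (N : ℕ) (j : ℤ) : ‖zetaN N ^ j - zetaN N ^ (-j)‖ ≤ 2 := by
  refine (norm_sub_le _ _).trans ?_
  rw [norm_zetaN_zpow, norm_zetaN_zpow]
  norm_num

lemma tsum_zetaN_mul_oddGeometric (N : ℕ) (k : ℤ) :
    ∑' m : ℤ, zetaN N ^ (k * m) * oddGeometric τ m =
      ∑' m : ℕ+, (zetaN N ^ (k * m) - zetaN N ^ (-(k * m))) * oddGeometric τ m := by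
  have hs : Summable fun m : ℤ => zetaN N ^ (k * m) * oddGeometric τ m := by
    refine Summable.of_norm ?_
    simp only [norm_mul, norm_zetaN_zpow, one_mul]
    exact (summable_oddGeometric τ).norm
  have hp : ∀ f : ℤ → ℂ, Summable f → Summable fun m : ℕ+ => f m := fun f hf =>
    hf.comp_injective fun a b h => PNat.coe_injective (by exact_mod_cast h)
  have hn : Summable fun m : ℕ+ => zetaN N ^ (k * -(m : ℤ)) * oddGeometric τ (-m) :=
    hp (fun m => zetaN N ^ (k * -m) * oddGeometric τ (-m))
      ((Equiv.neg ℤ).summable_iff.2 hs)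
  rw [tsum_int_eq_zero_add_tsum_pnat hs, oddGeometric_zero, mul_zero, zero_add,
    ← (hp _ hs).tsum_add hn]
  refine tsum_congr fun m => ?_
  rw [oddGeometric_neg, mul_neg, mul_neg, sub_mul, sub_eq_add_neg]

lemma summable_sub_zpow_mul_nome (N : ℕ) (k : ℤ) : Summable fun c : ℕ+ × ℕ+ =>
    (zetaN N ^ (k * c.1) - zetaN N ^ (-(k * c.1))) * nome τ ^ ((c.1 : ℕ) * c.2) := by
  refine Summable.of_norm_bounded ((summable_nome_pow_mul τ).norm.mul_left 2) fun c => ?_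
  rw [norm_mul]
  gcongr
  exact norm_le_two_of_sub_zpow N _

lemma gTerm_eq_tsum_divisorsAntidiagonal (N : ℕ) (k : ℤ) (n : ℕ+) :
    gTerm N k τ n = ∑' c : Nat.divisorsAntidiagonal n,
      (zetaN N ^ (k * (c.1.1 : ℕ)) - zetaN N ^ (-(k * (c.1.1 : ℕ)))) * nome τ ^ (c.1.1 * c.1.2) := by
  rw [tsum_fintype, Finset.univ_eq_attach, Finset.sum_attach (Nat.divisorsAntidiagonal n)
    (fun c => (zetaN N ^ (k * (c.1 : ℕ)) - zetaN N ^ (-(k * (c.1 : ℕ)))) * nome τ ^ (c.1 * c.2)),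
    gTerm, Finset.sum_mul, Nat.sum_divisorsAntidiagonal
      (fun a b => (zetaN N ^ (k * (a : ℕ)) - zetaN N ^ (-(k * (a : ℕ)))) * nome τ ^ (a * b))]
  refine Finset.sum_congr rfl fun d hd => ?_
  rw [Nat.mul_div_cancel' (Nat.dvd_of_mem_divisors hd)]

lemma summable_sigma_sub_zpow_mul_nome (N : ℕ) (k : ℤ) :
    Summable fun c : (Σ n : ℕ+, Nat.divisorsAntidiagonal n) =>
      (zetaN N ^ (k * (c.2.1.1 : ℕ)) - zetaN N ^ (-(k * (c.2.1.1 : ℕ)))) *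
        nome τ ^ (c.2.1.1 * c.2.1.2) :=
  sigmaAntidiagonalEquivProd.summable_iff.2 (summable_sub_zpow_mul_nome τ N k)

lemma summable_gTerm (N : ℕ) (k : ℤ) : Summable (gTerm N k τ) :=
  (summable_sigma_sub_zpow_mul_nome τ N k).sigma.congr fun n =>
    (gTerm_eq_tsum_divisorsAntidiagonal τ N k n).symm

/-- The Lambert series of `g_k`. -/
lemma tsum_gTerm (N : ℕ) (k : ℤ) : ∑' n, gTerm N k τ n =
    ∑' m : ℕ+, (zetaN N ^ (k * m) - zetaN N ^ (-(k * m))) * oddGeometric τ m := by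
  have h1 : ∑' n, gTerm N k τ n = ∑' c : ℕ+ × ℕ+,
      (zetaN N ^ (k * c.1) - zetaN N ^ (-(k * c.1))) * nome τ ^ ((c.1 : ℕ) * c.2) := by
    rw [← sigmaAntidiagonalEquivProd.tsum_eq, tsum_congr
      (gTerm_eq_tsum_divisorsAntidiagonal τ N k)]
    exact (summable_sigma_sub_zpow_mul_nome τ N k).tsum_sigma.symm
  rw [h1, (summable_sub_zpow_mul_nome τ N k).tsum_prod]
  refine tsum_congr fun m => ?_
  simp only
  rw [tsum_mul_left, oddGeometric_pnat]

/-- The Lambert series of `g_k`, summed in the other order. -/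
lemma tsum_gTerm_comm (N : ℕ) (k : ℤ) : ∑' n, gTerm N k τ n =
    ∑' m : ℕ+, ∑' n : ℕ+,
      (zetaN N ^ (k * n) - zetaN N ^ (-(k * n))) * nome τ ^ ((n : ℕ) * m) := by
  have h := Summable.tsum_comm (f := fun n m : ℕ+ =>
    (zetaN N ^ (k * n) - zetaN N ^ (-(k * n))) * nome τ ^ ((n : ℕ) * m))
    (summable_sub_zpow_mul_nome τ N k)
  rw [h, tsum_gTerm]
  refine tsum_congr fun m => ?_
  rw [oddGeometric_pnat, ← tsum_mul_left]

end Lambert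

/-! ### Evaluation of the dual sum on `ℤτ + ℤ`. -/

section Evaluation

/-- The pair of periods `(τ, 1)`. -/
noncomputable def upperPair (τ : ℍ) : PeriodPair where
  ω₁ := τ
  ω₂ := 1
  indep := by
    rw [LinearIndependent.pair_iff]
    intro a b h
    have h1 := congrArg Complex.im h
    have h2 := congrArg Complex.re h
    have := τ.im_ne_zero
    simp at h1 h2
    have ha : a = 0 := h1.resolve_right this
    subst ha
    simpa using h2

lemma latticePoint_upperPair (τ : ℍ) (x : ℤ × ℤ) :
    latticePoint (upperPair τ) x = x.1 * τ + x.2 := by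
  simp [latticePoint_apply, upperPair]

lemma wedge_upperPair (τ : ℍ) : wedge (upperPair τ).ω₁ (upperPair τ).ω₂ < 0 := by
  have := τ.im_pos
  simpa [wedge, upperPair] using this

lemma int_mul_mem_integerComplement (τ : ℍ) {m : ℤ} (hm : m ≠ 0) :
    (m * τ : ℂ) ∈ integerComplement := by
  rw [mem_integerComplement_iff]
  rintro ⟨n, hn⟩
  have h1 := congrArg Complex.im hn
  have := τ.im_ne_zero
  simp [hm] at h1
  exact this h1

lemma tendsto_sum_Icc_inv_int_mul_add (τ : ℍ) (m : ℤ) :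
    Tendsto (fun M : ℕ => ∑ n ∈ Icc (-(M : ℤ)) M, ((m * τ : ℂ) + n)⁻¹) atTop
      (𝓝 (Real.pi * cot (Real.pi * (m * τ)))) := by
  by_cases hm : m = 0
  -- The row `m = 0` sums to `0` by oddness, with `0⁻¹ = 0` for the omitted term, which matches `cot
  -- 0 = 0`.
  · subst hm
    simp only [Int.cast_zero, zero_mul, sum_Icc_inv_eq_zero]
    simp [cot]
  · exact tendsto_sum_Icc_inv_add (int_mul_mem_integerComplement τ hm)

/-- The second difference of the sign is supported at `±1`, with values `±1`; at `0` the
contributions of the two neighbours cancel. -/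
lemma hasSum_sign_secondDifference (f : ℤ → ℂ) :
    HasSum (fun m : ℤ => f m * (2 * m.sign - (m + 1).sign - (m - 1).sign : ℂ)) (f 1 - f (-1)) := by
  have h := hasSum_sum_of_ne_finset_zero (L := .unconditional ℤ) (s := ({1, -1} : Finset ℤ))
    (f := fun m : ℤ => f m * (2 * m.sign - (m + 1).sign - (m - 1).sign : ℂ)) fun m hm => by
      simp only [Finset.mem_insert, Finset.mem_singleton, not_or] at hm
      rcases lt_trichotomy m 0 with h | rfl | h
      · rw [Int.sign_eq_neg_one_of_neg h, Int.sign_eq_neg_one_of_neg (by omega),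
          Int.sign_eq_neg_one_of_neg (by omega)]
        push_cast; ring
      · simp
      · rw [Int.sign_eq_one_of_pos h, Int.sign_eq_one_of_pos (by omega),
          Int.sign_eq_one_of_pos (by omega)]
        push_cast; ring
  rw [Finset.sum_pair (by norm_num)] at h
  have e2 : Int.sign 2 = 1 := rfl
  convert h using 1
  norm_num [e2]
  ring

lemma tsum_heckeSecondDifference_right (τ : ℍ) (m : ℤ)
    (h : Summable fun n : ℤ => heckeSecondDifference (upperPair τ) 0 (1, 0) (m, n)) :
    ∑' n : ℤ, heckeSecondDifference (upperPair τ) 0 (1, 0) (m, n) =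
      2 * (Real.pi * cot (Real.pi * (m * τ))) - Real.pi * cot (Real.pi * ((m + 1 : ℤ) * τ))
        - Real.pi * cot (Real.pi * ((m - 1 : ℤ) * τ)) := by
  refine tendsto_nhds_unique (tendsto_sum_Icc_of_summable h) ?_
  refine ((((tendsto_sum_Icc_inv_int_mul_add τ m).const_mul 2).sub
    (tendsto_sum_Icc_inv_int_mul_add τ (m + 1))).sub
    (tendsto_sum_Icc_inv_int_mul_add τ (m - 1))).congr fun M => ?_
  rw [Finset.mul_sum, ← Finset.sum_sub_distrib, ← Finset.sum_sub_distrib]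
  refine Finset.sum_congr rfl fun n _ => ?_
  simp only [heckeSecondDifference, heckeTerm_zero_left, latticePoint_upperPair, Prod.mk_add_mk,
    Prod.mk_sub_mk, add_zero, sub_zero]

lemma one_div_I_mul_D₀ {z : ℂ} (hz : ‖z‖ = 1) (h1 : z ≠ 1) :
    1 / I * (D₀ z : ℂ) = -(1 + z) / (2 * (1 - z)) := by
  have h0 : z ≠ 0 := norm_pos_iff.1 (by rw [hz]; norm_num)
  have hc : (starRingEnd ℂ) z = z⁻¹ := (Complex.inv_eq_conj hz).symm
  have h2 : 1 - z ≠ 0 := sub_ne_zero.2 h1.symm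
  have h3 : z - 1 ≠ 0 := sub_ne_zero.2 h1
  have h4 : 1 - z⁻¹ ≠ 0 := by
    intro h
    exact h1 (inv_eq_one.1 (sub_eq_zero.1 h).symm)
  rw [D₀, if_neg h1, Complex.im_eq_sub_conj, map_div₀, map_sub, map_one, hc]
  have h5 : z⁻¹ / (1 - z⁻¹) = 1 / (z - 1) := by
    field_simp
  rw [h5, show (1 : ℂ) / (z - 1) = -(1 / (1 - z)) by rw [← neg_sub, div_neg]]
  field_simp
  rw [I_sq]
  ring

variable {N : ℕ}

lemma torsionChar_zero_right (k : ℤ) (x : ℤ × ℤ) : torsionChar N k 0 x = zetaN N ^ (k * x.1) := by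
  simp [torsionChar]

/-- The finite Fourier transform of Hecke's Eisenstein series is the Lambert series `g_k`. -/
lemma dualSum_upperPair (hN : 0 < N) (k : ℤ) (τ : ℍ) :
    dualSum N (upperPair τ) k 0 = 2 * Real.pi * I * g N k τ := by
  set z := zetaN N ^ k with hz
  have hz0 : z ≠ 0 := zpow_ne_zero _ (zetaN_ne_zero N)
  -- For `z = 1` both sides are zero: the twisted series is odd, and `D₀ 1 = 0` with all
  -- `q`-coefficients zero.
  by_cases h1 : z = 1
  · have hk : ∀ m : ℤ, zetaN N ^ (k * m) = 1 := fun m => by rw [zpow_mul, ← hz, h1, one_zpow]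
    rw [dualSum_eq_zero _ hN fun x => by rw [torsionChar_zero_right, hk]]
    have hg : ∀ n, gTerm N k τ n = 0 := fun n => by
      simp [gTerm, zpow_neg, hk]
    simp only [g, ← hz, h1, hg, tsum_zero, D₀]
    simp
  -- The character is trivial on `(0, 1)`, so the differences are taken along `τ`, where its value
  -- is `z ≠ 1`.
  have hmul := mul_dualSum (upperPair τ) hN k 0 (1, 0)
  have hs := summable_mul_heckeSecondDifference (upperPair τ) (1, 0) (norm_torsionChar N k 0)
    (s := 0) (by norm_num)
  have hc : ∀ m : ℤ, zetaN N ^ (k * m) ≠ 0 := fun m => zpow_ne_zero _ (zetaN_ne_zero N)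
  have hs' : ∀ m : ℤ, Summable fun n : ℤ =>
      heckeSecondDifference (upperPair τ) 0 (1, 0) (m, n) := fun m => by
    have := hs.prod_factor m
    simp only [torsionChar_zero_right] at this
    exact (summable_mul_left_iff (hc m)).1 this
  have hi : ∀ m : ℤ, ∑' n : ℤ, torsionChar N k 0 (m, n) *
      heckeSecondDifference (upperPair τ) 0 (1, 0) (m, n) =
      -(Real.pi * I) * (zetaN N ^ (k * m) * (2 * m.sign - (m + 1).sign - (m - 1).sign : ℂ))
      + -(2 * Real.pi * I) * (2 * (zetaN N ^ (k * m) * oddGeometric τ m)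
        - zetaN N ^ (k * m) * oddGeometric τ (m + 1)
        - zetaN N ^ (k * m) * oddGeometric τ (m - 1)) := fun m => by
    simp only [torsionChar_zero_right]
    rw [tsum_mul_left, tsum_heckeSecondDifference_right τ m (hs' m), pi_mul_cot_int_mul,
      pi_mul_cot_int_mul, pi_mul_cot_int_mul]
    ring
  have hb : ∀ j : ℤ, Summable fun m : ℤ => zetaN N ^ (k * m) * oddGeometric τ (m + j) := fun j => by
    refine Summable.of_norm ?_
    simp only [norm_mul, norm_zetaN_zpow, one_mul]
    exact ((Equiv.addRight j).summable_iff.2 (summable_oddGeometric τ)).norm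
  have hshift : ∀ j : ℤ, ∑' m : ℤ, zetaN N ^ (k * m) * oddGeometric τ (m + j) =
      zetaN N ^ (k * -j) * ∑' m : ℤ, zetaN N ^ (k * m) * oddGeometric τ m := fun j => by
    rw [← tsum_mul_left, ← (Equiv.addRight j).tsum_eq
      (fun m => zetaN N ^ (k * -j) * (zetaN N ^ (k * m) * oddGeometric τ m))]
    refine tsum_congr fun m => ?_
    rw [Equiv.coe_addRight, ← mul_assoc, ← zpow_add₀ (zetaN_ne_zero N)]
    congr 2
    ring
  have hd := hasSum_sign_secondDifference fun m => zetaN N ^ (k * m)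
  have hB0 := hb 0
  simp only [add_zero] at hB0
  have hB1 := hb 1
  have hB2 := hb (-1)
  have ht := hshift (-1)
  simp only [← sub_eq_add_neg] at hB2 ht
  rw [hs.tsum_prod, tsum_congr hi,
    ((hd.summable.mul_left _).tsum_add ((((hB0.mul_left 2).sub hB1).sub hB2).mul_left _)),
    tsum_mul_left, tsum_mul_left, hd.tsum_eq, ((hB0.mul_left 2).sub hB1).tsum_sub hB2,
    (hB0.mul_left 2).tsum_sub hB1, tsum_mul_left, hshift 1, ht, tsum_zetaN_mul_oddGeometric,
    ← tsum_gTerm, torsionChar_zero_right, torsionChar_zero_right] at hmul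
  simp only [Prod.neg_mk, mul_neg, mul_one, neg_neg, zpow_neg, ← hz] at hmul
  rw [g, ← hz, one_div_I_mul_D₀ (z := z) (norm_zetaN_zpow N k) h1]
  have h2 : 1 - z ≠ 0 := sub_ne_zero.2 (Ne.symm h1)
  have h3 : (2 - z - z⁻¹) ≠ 0 := by
    have : 2 - z - z⁻¹ = -(1 - z) ^ 2 / z := by field_simp; ring
    rw [this]
    exact div_ne_zero (neg_ne_zero.2 (pow_ne_zero 2 h2)) hz0
  -- The sign part contributes `-πi (z - z⁻¹)`, and dividing by `2 - z - z⁻¹` turns it into `-πi (1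
  -- + z) / (1 - z)`, the constant term.
  refine mul_left_cancel₀ h3 (hmul.trans ?_)
  field_simp
  ring

end Evaluation

/-! ### Homogeneity, and period pairs for arbitrary lattices. -/

section Scaling

/-- The pair of periods `(c ω₁, c ω₂)`. -/
noncomputable def scalePair (P : PeriodPair) {c : ℂ} (hc : c ≠ 0) : PeriodPair where
  ω₁ := c * P.ω₁
  ω₂ := c * P.ω₂
  indep := by
    have h := P.indep
    rw [LinearIndependent.pair_iff] at h ⊢
    intro a b hab
    refine h a b (mul_left_cancel₀ hc ?_)
    simp only [real_smul] at hab ⊢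
    linear_combination hab

lemma latticePoint_scalePair (P : PeriodPair) {c : ℂ} (hc : c ≠ 0) (x : ℤ × ℤ) :
    latticePoint (scalePair P hc) x = c * latticePoint P x := by
  simp only [latticePoint_apply, scalePair]
  ring

lemma wedge_mul_mul (c u v : ℂ) : wedge (c * u) (c * v) = normSq c * wedge u v := by
  simp [wedge, normSq_apply]
  ring

lemma wedge_scalePair (P : PeriodPair) {c : ℂ} (hc : c ≠ 0) (hP : wedge P.ω₁ P.ω₂ < 0) :
    wedge (scalePair P hc).ω₁ (scalePair P hc).ω₂ < 0 := by
  simp only [scalePair, wedge_mul_mul]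
  exact mul_neg_of_pos_of_neg (normSq_pos.2 hc) hP

variable {N : ℕ}

/-- At `s = 0` every term of the second-difference formula is homogeneous of degree `-1`. -/
lemma dualSum_scalePair (hN : 0 < N) (P : PeriodPair) {c : ℂ} (hc : c ≠ 0) (k l : ℤ) :
    dualSum N (scalePair P hc) k l = c⁻¹ * dualSum N P k l := by
  by_cases h : ∀ ℓ, torsionChar N k l ℓ = 1
  · rw [dualSum_eq_zero _ hN h, dualSum_eq_zero _ hN h, mul_zero]
  · push Not at h
    obtain ⟨ℓ, hℓ⟩ := h
    refine mul_left_cancel₀ (two_sub_character_ne_zero (norm_torsionChar N k l)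
      (torsionChar_add N k l) hℓ) ?_
    rw [mul_left_comm, mul_dualSum _ hN, mul_dualSum _ hN, ← tsum_mul_left]
    refine tsum_congr fun x => ?_
    simp only [heckeSecondDifference, heckeTerm_zero_left, latticePoint_scalePair, mul_inv]
    ring

lemma dualSum_congr (hN : 0 < N) (P : PeriodPair) {k l k' l' : ℤ} (hk : (N : ℤ) ∣ k - k')
    (hl : (N : ℤ) ∣ l - l') : dualSum N P k l = dualSum N P k' l' := by
  have key : ∀ {a b : ℤ}, (N : ℤ) ∣ a - b → ∀ m : ℤ, zetaN N ^ (a * m) = zetaN N ^ (b * m) := by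
    rintro a b ⟨c, hc⟩ m
    rw [show a * m = b * m + N * (c * m) by linear_combination m * hc,
      zpow_add₀ (zetaN_ne_zero N), zpow_mul _ (N : ℤ), zpow_natCast,
      (isPrimitiveRoot_zetaN hN).pow_eq_one, one_zpow, mul_one]
  have : torsionChar N k l = torsionChar N k' l' := by
    funext x
    rw [torsionChar, torsionChar, zpow_add₀ (zetaN_ne_zero N), zpow_add₀ (zetaN_ne_zero N),
      key hk, key hl]
  simp only [dualSum, this]

lemma sum_Gab (τ : ℍ) (k : ℤ) :
    ∑ a ∈ range N, ∑ b ∈ range N, zetaN N ^ (k * a) * Gab N a b τ = dualSum N (upperPair τ) k 0 := by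
  refine Finset.sum_congr rfl fun a _ => Finset.sum_congr rfl fun b _ => ?_
  rw [torsionChar_zero_right, latticePoint_upperPair, Gab]
  rfl

lemma G'_two_pi_I (hN : 0 < N) (k : ℤ) (τ : ℍ) :
    G' N (Submodule.span ℤ {2 * Real.pi * I, 2 * Real.pi * I * (τ : ℂ)})
      (2 * Real.pi * I * k / N) = g N k τ := by
  have hc : (2 * Real.pi * I : ℂ) ≠ 0 := two_pi_I_ne_zero
  have hL : Submodule.span ℤ {2 * Real.pi * I, 2 * Real.pi * I * (τ : ℂ)} =
      (scalePair (upperPair τ) hc).lattice := by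
    simp only [PeriodPair.lattice, scalePair, upperPair, mul_one]
    rw [Set.pair_comm]
  have hu : (2 * Real.pi * I * k / N : ℂ) =
      latticePoint (scalePair (upperPair τ) hc) (0, k) / N := by
    rw [latticePoint_scalePair, latticePoint_upperPair]
    simp
  rw [hL, hu, G'_latticePoint hN _ (wedge_scalePair _ hc (wedge_upperPair τ)), neg_zero,
    dualSum_scalePair hN, dualSum_upperPair hN, inv_mul_cancel_left₀ hc]

lemma exists_periodPair_lattice_eq (L : Submodule ℤ ℂ) [DiscreteTopology L] [IsZLattice ℝ L] :
    ∃ P : PeriodPair, P.lattice = L := by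
  have : Module.Free ℤ L := ZLattice.module_free ℝ L
  have : Module.Finite ℤ L := ZLattice.module_finite ℝ L
  have hr : Module.finrank ℤ L = 2 := by
    rw [ZLattice.rank ℝ L, Complex.finrank_real_complex]
  let b := Module.finBasisOfFinrankEq ℤ L hr
  have hli := (b.ofZLatticeBasis ℝ L).linearIndependent
  have hspan := b.ofZLatticeBasis_span ℝ L
  have hv : ⇑(b.ofZLatticeBasis ℝ L) = ![(b 0 : ℂ), (b 1 : ℂ)] := by
    funext i
    fin_cases i <;> simp
  rw [hv] at hli hspan
  refine ⟨⟨b 0, b 1, hli⟩, Eq.trans ?_ hspan⟩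
  rw [PeriodPair.lattice]
  simp [Matrix.range_cons, Set.pair_comm]

lemma exists_latticePoint_div_eq (hN : 0 < N) {P : PeriodPair} {u : ℂ} (hu : N * u ∈ P.lattice) :
    ∃ y, latticePoint P y / N = u := by
  have hN' : (N : ℂ) ≠ 0 := by exact_mod_cast hN.ne'
  obtain ⟨y, hy⟩ := mem_lattice_iff_latticePoint.1 hu
  exact ⟨y, by rw [hy, mul_div_cancel_left₀ _ hN']⟩

end Scaling

/-! ### Transformation under `SL(2, ℤ)` and invariance under `Γ₁(N)`. -/

section Modularity

open scoped ModularForm Manifold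

variable {N : ℕ}

lemma mem_lattice_upperPair {τ : ℍ} {z : ℂ} :
    z ∈ (upperPair τ).lattice ↔ ∃ m n : ℤ, m * (τ : ℂ) + n = z := by
  rw [PeriodPair.mem_lattice]
  simp [upperPair]

lemma denom_SL (γ : Matrix.SpecialLinearGroup (Fin 2) ℤ) (τ : ℍ) :
    UpperHalfPlane.denom γ τ = (γ 1 0 : ℂ) * τ + (γ 1 1 : ℂ) := by
  simp [UpperHalfPlane.denom]

lemma denom_mul_smul (γ : Matrix.SpecialLinearGroup (Fin 2) ℤ) (τ : ℍ) :
    UpperHalfPlane.denom γ τ * ((γ • τ : ℍ) : ℂ) = (γ 0 0 : ℂ) * τ + (γ 0 1 : ℂ) := by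
  have h := UpperHalfPlane.denom_ne_zero γ τ
  rw [UpperHalfPlane.specialLinearGroup_apply]
  rw [denom_SL] at h ⊢
  simp only [algebraMap_int_eq, eq_intCast, ofReal_intCast]
  field_simp

lemma lattice_scalePair_smul (γ : Matrix.SpecialLinearGroup (Fin 2) ℤ) (τ : ℍ) :
    (scalePair (upperPair (γ • τ)) (UpperHalfPlane.denom_ne_zero γ τ)).lattice =
      (upperPair τ).lattice := by
  have hdet : γ 0 0 * γ 1 1 - γ 0 1 * γ 1 0 = 1 := by
    rw [← Matrix.det_fin_two, γ.det_coe]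
  have hdet' : (γ 0 0 : ℂ) * γ 1 1 - γ 0 1 * γ 1 0 = 1 := by exact_mod_cast hdet
  have h1 := denom_mul_smul γ τ
  have h2 := denom_SL γ τ
  ext z
  rw [mem_lattice_upperPair, PeriodPair.mem_lattice]
  simp only [scalePair, upperPair, mul_one, h1]
  rw [h2]
  constructor
  · rintro ⟨m, n, rfl⟩
    refine ⟨m * γ 0 0 + n * γ 1 0, m * γ 0 1 + n * γ 1 1, ?_⟩
    push_cast
    ring
  · rintro ⟨m, n, rfl⟩
    refine ⟨m * γ 1 1 - n * γ 1 0, n * γ 0 0 - m * γ 0 1, ?_⟩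
    push_cast
    linear_combination (m * τ + n : ℂ) * hdet'

/-- Transformation of the dual sums under `SL(2, ℤ)`. -/
lemma dualSum_smul (hN : 0 < N) (k : ℤ) (γ : Matrix.SpecialLinearGroup (Fin 2) ℤ) (τ : ℍ) :
    dualSum N (upperPair (γ • τ)) k 0 =
      UpperHalfPlane.denom γ τ * dualSum N (upperPair τ) (k * γ 1 1) (-(k * γ 1 0)) := by
  have hd := UpperHalfPlane.denom_ne_zero γ τ
  have h1 := G'_latticePoint hN (scalePair (upperPair (γ • τ)) hd)
    (wedge_scalePair _ hd (wedge_upperPair _)) (0, k)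
  have h2 := G'_latticePoint hN (upperPair τ) (wedge_upperPair τ) (k * γ 1 0, k * γ 1 1)
  -- After scaling by the factor of automorphy, both pairs span the same lattice, and this is the
  -- same point in the two coordinate systems.
  have hp : latticePoint (scalePair (upperPair (γ • τ)) hd) (0, k) =
      latticePoint (upperPair τ) (k * γ 1 0, k * γ 1 1) := by
    rw [latticePoint_scalePair, latticePoint_upperPair, latticePoint_upperPair, denom_SL]
    push_cast
    ring
  rw [lattice_scalePair_smul, hp, h2, neg_zero, dualSum_scalePair hN] at h1
  rw [h1, mul_inv_cancel_left₀ hd]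

lemma g_smul (hN : 0 < N) (k : ℤ) (γ : Matrix.SpecialLinearGroup (Fin 2) ℤ) (τ : ℍ) :
    2 * Real.pi * I * g N k (γ • τ) =
      UpperHalfPlane.denom γ τ * dualSum N (upperPair τ) (k * γ 1 1) (-(k * γ 1 0)) := by
  rw [← dualSum_upperPair hN, dualSum_smul hN]

lemma slash_g (hN : 0 < N) (k : ℤ) (γ : Matrix.SpecialLinearGroup (Fin 2) ℤ) (τ : ℍ) :
    (g N k ∣[(1 : ℤ)] γ) τ =
      (2 * Real.pi * I)⁻¹ * dualSum N (upperPair τ) (k * γ 1 1) (-(k * γ 1 0)) := by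
  have hd := UpperHalfPlane.denom_ne_zero γ τ
  have h := g_smul hN k γ τ
  have hc : (2 * Real.pi * I : ℂ) ≠ 0 := two_pi_I_ne_zero
  rw [ModularForm.SL_slash_apply, zpow_neg_one, ← div_eq_mul_inv, div_eq_iff hd,
    eq_comm, ← mul_right_inj' hc, h]
  field_simp

lemma slash_g_of_mem_Gamma1 (hN : 0 < N) (k : ℤ) {γ : Matrix.SpecialLinearGroup (Fin 2) ℤ}
    (hγ : γ ∈ CongruenceSubgroup.Gamma1 N) : g N k ∣[(1 : ℤ)] γ = g N k := by
  rw [CongruenceSubgroup.Gamma1_mem] at hγ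
  obtain ⟨-, h11, h10⟩ := hγ
  have h1 : (N : ℤ) ∣ γ 1 1 - 1 := by
    rw [← ZMod.intCast_zmod_eq_zero_iff_dvd]; push_cast; rw [h11, sub_self]
  have h0 : (N : ℤ) ∣ γ 1 0 := by
    rw [← ZMod.intCast_zmod_eq_zero_iff_dvd]; exact h10
  funext τ
  rw [slash_g hN, dualSum_congr hN _ (k' := k) (l' := 0), dualSum_upperPair hN,
    inv_mul_cancel_left₀ two_pi_I_ne_zero]
  · rw [show k * γ 1 1 - k = k * (γ 1 1 - 1) by ring]
    exact h1.mul_left k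
  · rw [sub_zero, Int.dvd_neg]
    exact h0.mul_left k

end Modularity

/-! ### Holomorphy on the upper half plane and boundedness at infinity. -/

section Holomorphy

open scoped ModularForm Manifold

variable (N : ℕ) (k : ℤ)

lemma norm_nome (τ : ℍ) : ‖nome τ‖ = Real.exp (-2 * Real.pi * τ.im) := by
  rw [nome, Complex.norm_exp]
  simp

lemma tsum_gTerm_eq_tsum_prod (τ : ℍ) : ∑' n, gTerm N k τ n = ∑' c : ℕ+ × ℕ+,
    (zetaN N ^ (k * c.1) - zetaN N ^ (-(k * c.1))) * nome τ ^ ((c.1 : ℕ) * c.2) := by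
  rw [tsum_gTerm, (summable_sub_zpow_mul_nome τ N k).tsum_prod]
  refine tsum_congr fun m => ?_
  simp only
  rw [tsum_mul_left, oddGeometric_pnat]

lemma summable_exp_pow_mul {δ : ℝ} (hδ : 0 < δ) : Summable fun c : ℕ+ × ℕ+ =>
    2 * Real.exp (-2 * Real.pi * δ) ^ ((c.1 : ℕ) * c.2) := by
  obtain ⟨τ, hτ⟩ : ∃ τ : ℍ, τ.im = δ :=
    ⟨⟨δ * I, by simpa using hδ⟩, by rw [← UpperHalfPlane.coe_im]; simp⟩
  have h := (summable_nome_pow_mul τ).norm.mul_left 2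
  simpa only [norm_pow, norm_nome, hτ] using h

lemma isBoundedAtImInfty_g : UpperHalfPlane.IsBoundedAtImInfty (g N k) := by
  rw [UpperHalfPlane.isBoundedAtImInfty_iff]
  refine ⟨‖1 / I * (D₀ (zetaN N ^ k) : ℂ)‖ + ∑' c : ℕ+ × ℕ+,
    2 * Real.exp (-2 * Real.pi * 1) ^ ((c.1 : ℕ) * c.2), 1, fun τ hτ => ?_⟩
  rw [g, tsum_gTerm_eq_tsum_prod]
  refine (norm_sub_le _ _).trans (add_le_add_right ?_ _)
  refine tsum_of_norm_bounded (summable_exp_pow_mul one_pos).hasSum fun c => ?_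
  rw [norm_mul, norm_pow, norm_nome]
  gcongr ?_ * ?_ ^ _
  · exact norm_le_two_of_sub_zpow N _
  · have := Real.pi_pos
    exact Real.exp_le_exp.2 (by nlinarith)

lemma mdifferentiable_g : MDiff (g N k) := by
  rw [UpperHalfPlane.mdifferentiable_iff]
  have key : ∀ δ : ℝ, 0 < δ → DifferentiableOn ℂ (fun z => ∑' c : ℕ+ × ℕ+,
      (zetaN N ^ (k * c.1) - zetaN N ^ (-(k * c.1))) *
        cexp (2 * Real.pi * I * z) ^ ((c.1 : ℕ) * c.2)) {z | δ < z.im} := fun δ hδ => by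
    refine differentiableOn_tsum_of_summable_norm (summable_exp_pow_mul hδ) (fun c => ?_)
      (isOpen_lt continuous_const continuous_im) fun c z hz => ?_
    · fun_prop
    · have hz' : δ < z.im := hz
      rw [norm_mul, norm_pow, Complex.norm_exp]
      gcongr ?_ * ?_ ^ _
      · exact norm_le_two_of_sub_zpow N _
      · have := Real.pi_pos
        refine Real.exp_le_exp.2 ?_
        simp
        nlinarith
  have hF : DifferentiableOn ℂ (fun z => 1 / I * (D₀ (zetaN N ^ k) : ℂ) - ∑' c : ℕ+ × ℕ+,
      (zetaN N ^ (k * c.1) - zetaN N ^ (-(k * c.1))) *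
        cexp (2 * Real.pi * I * z) ^ ((c.1 : ℕ) * c.2)) {z | 0 < z.im} := fun z hz => by
    have hz' : 0 < z.im := hz
    -- The series is dominated uniformly only on `Im > δ` with `δ > 0`, and `z.im / 2` puts `z`
    -- inside such a half-plane.
    refine ((differentiableAt_const _).sub ((key (z.im / 2) (by linarith)).differentiableAt
      ((isOpen_lt continuous_const continuous_im).mem_nhds ?_))).differentiableWithinAt
    simp only [Set.mem_ofPred_eq]
    linarith
  refine hF.congr fun z hz => ?_
  rw [Function.comp_apply, g, tsum_gTerm_eq_tsum_prod, nome,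
    UpperHalfPlane.ofComplex_apply_of_im_pos hz]

end Holomorphy

/-! ### Boundedness at all cusps. -/

section Cusps

open scoped ModularForm Manifold

/-- Away from `0` and `±1` the expression is `-2 / (w (w + 1) (w - 1))`, and a product is at most
the sum of the cubes. At the three exceptional points the convention `0⁻¹ = 0` requires a direct
check. -/
lemma norm_secondDifference_inv_le (w : ℂ) :
    ‖2 * w⁻¹ - (w + 1)⁻¹ - (w - 1)⁻¹‖ ≤
      2 * (‖w‖⁻¹ ^ 3 + ‖w + 1‖⁻¹ ^ 3 + ‖w - 1‖⁻¹ ^ 3) := by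
  by_cases h0 : w = 0
  · subst h0
    norm_num
  by_cases h1 : w + 1 = 0
  · obtain rfl : w = -1 := by linear_combination h1
    norm_num
  by_cases h2 : w - 1 = 0
  · obtain rfl : w = 1 := by linear_combination h2
    norm_num
  have e : 2 * w⁻¹ - (w + 1)⁻¹ - (w - 1)⁻¹ = -2 * (w⁻¹ * (w + 1)⁻¹ * (w - 1)⁻¹) := by
    field_simp
    ring
  rw [e, norm_mul, norm_mul, norm_mul, norm_neg, norm_inv, norm_inv, norm_inv]
  set a := ‖w‖⁻¹
  set b := ‖w + 1‖⁻¹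
  set c := ‖w - 1‖⁻¹
  have ha : 0 ≤ a := by positivity
  have hb : 0 ≤ b := by positivity
  have hc : 0 ≤ c := by positivity
  have h3 : a * b * c ≤ a ^ 3 + b ^ 3 + c ^ 3 := by
    nlinarith [mul_nonneg ha (sq_nonneg (b - c)), mul_nonneg hb (sq_nonneg (a - c)),
      mul_nonneg hc (sq_nonneg (a - b)), mul_nonneg (add_nonneg ha hb) (sq_nonneg (a - b)),
      mul_nonneg (add_nonneg ha hc) (sq_nonneg (a - c)),
      mul_nonneg (add_nonneg hb hc) (sq_nonneg (b - c)), pow_nonneg ha 3, pow_nonneg hb 3,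
      pow_nonneg hc 3]
  rw [show ‖(2 : ℂ)‖ = 2 by simp]
  linarith

lemma summable_norm_latticePoint_inv_pow (P : PeriodPair) :
    Summable fun x => ‖latticePoint P x‖⁻¹ ^ 3 := by
  refine (summable_norm_latticePoint_rpow P (r := -3) (by norm_num)).congr fun x => ?_
  rw [Real.rpow_neg (norm_nonneg _), inv_pow]
  norm_cast

lemma tsum_norm_latticePoint_vadd (τ : ℍ) (j : ℤ) :
    ∑' x, ‖latticePoint (upperPair ((j : ℝ) +ᵥ τ)) x‖⁻¹ ^ 3 =
      ∑' x, ‖latticePoint (upperPair τ) x‖⁻¹ ^ 3 := by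
  let e : ℤ × ℤ ≃ ℤ × ℤ :=
    { toFun := fun x => (x.1, x.2 + j * x.1)
      invFun := fun x => (x.1, x.2 - j * x.1)
      left_inv := fun x => by simp
      right_inv := fun x => by simp }
  rw [← e.tsum_eq fun x => ‖latticePoint (upperPair τ) x‖⁻¹ ^ 3]
  refine tsum_congr fun x => ?_
  simp only [latticePoint_upperPair, e, Equiv.coe_fn_mk, UpperHalfPlane.coe_vadd]
  congr 3
  push_cast
  ring

/-- The Epstein sums `∑ |mτ + n|⁻³` are bounded for `Im τ ≥ 1`. -/
lemma exists_tsum_norm_latticePoint_le : ∃ C : ℝ, ∀ τ : ℍ, 1 ≤ τ.im →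
    ∑' x, ‖latticePoint (upperPair τ) x‖⁻¹ ^ 3 ≤ C := by
  refine ⟨∑' x : ℤ × ℤ, EisensteinSeries.r ⟨⟨1, 1⟩, one_pos⟩ ^ (-3 : ℝ) * ‖![x.1, x.2]‖ ^ (-3 : ℝ),
    fun τ hτ => ?_⟩
  -- Integer translation only shears the index set, so `Re τ` may be moved into `[0, 1)`, inside a
  -- vertical strip where the summands have a uniform bound.
  set j : ℤ := -⌊τ.re⌋
  rw [← tsum_norm_latticePoint_vadd τ j]
  set σ : ℍ := (j : ℝ) +ᵥ τ with hσ
  have hmem : σ ∈ UpperHalfPlane.verticalStrip 1 1 := by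
    refine ⟨?_, ?_⟩
    · rw [hσ, UpperHalfPlane.vadd_re]
      have h1 := Int.floor_le τ.re
      have h2 := Int.lt_floor_add_one τ.re
      rw [abs_le]
      simp only [j]
      push_cast
      constructor <;> linarith
    · rw [hσ, UpperHalfPlane.vadd_im]
      exact hτ
  have hs : Summable fun x : ℤ × ℤ => EisensteinSeries.r ⟨⟨1, 1⟩, one_pos⟩ ^ (-3 : ℝ) *
      ‖![x.1, x.2]‖ ^ (-3 : ℝ) := by
    refine Summable.mul_left _ ?_
    have := EisensteinSeries.summable_one_div_norm_rpow (k := 3) (by norm_num)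
    exact (finTwoArrowEquiv ℤ).symm.summable_iff.2 this
  refine (summable_norm_latticePoint_inv_pow _).tsum_le_tsum (fun x => ?_) hs
  have h := EisensteinSeries.summand_bound_of_mem_verticalStrip (z := σ) (k := 3) (by norm_num)
    ![x.1, x.2] one_pos hmem
  refine le_trans (le_of_eq ?_) h
  rw [latticePoint_upperPair, Real.rpow_neg (norm_nonneg _), inv_pow]
  norm_cast

variable {N : ℕ}

lemma isBoundedAtImInfty_dualSum (hN : 0 < N) (k l : ℤ) :
    UpperHalfPlane.IsBoundedAtImInfty fun τ => dualSum N (upperPair τ) k l := by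
  by_cases hl : zetaN N ^ l = 1
  · have hdvd := ((isPrimitiveRoot_zetaN hN).zpow_eq_one_iff_dvd l).1 hl
    have : (fun τ => dualSum N (upperPair τ) k l) = fun τ => 2 * Real.pi * I * g N k τ := by
      funext τ
      rw [← dualSum_upperPair hN]
      exact dualSum_congr hN _ (by simp) (by simpa using hdvd)
    rw [this]
    exact (isBoundedAtImInfty_g N k).const_mul_left _
  -- Here the character is nontrivial on `1`, a period independent of `τ`, so the second differences
  -- stay controlled as `Im τ` grows.
  · obtain ⟨C, hC⟩ := exists_tsum_norm_latticePoint_le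
    have hχ : torsionChar N k l (0, 1) ≠ 1 := by simpa [torsionChar] using hl
    have hne := two_sub_character_ne_zero (norm_torsionChar N k l) (torsionChar_add N k l) hχ
    set t := 2 - torsionChar N k l (0, 1) - torsionChar N k l (-(0, 1)) with ht
    rw [UpperHalfPlane.isBoundedAtImInfty_iff]
    refine ⟨‖t‖⁻¹ * (2 * (C + C + C)), 1, fun τ hτ => ?_⟩
    have h := mul_dualSum (upperPair τ) hN k l (0, 1)
    rw [← ht] at h
    have h2 : dualSum N (upperPair τ) k l = t⁻¹ * ∑' x, torsionChar N k l x *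
        heckeSecondDifference (upperPair τ) 0 (0, 1) x := by
      rw [← h, inv_mul_cancel_left₀ hne]
    rw [h2, norm_mul, norm_inv]
    gcongr
    have hS := summable_norm_latticePoint_inv_pow (upperPair τ)
    have hS1 := (Equiv.addRight ((0, 1) : ℤ × ℤ)).summable_iff.2 hS
    have hS2 := (Equiv.subRight ((0, 1) : ℤ × ℤ)).summable_iff.2 hS
    have hT1 := (Equiv.addRight ((0, 1) : ℤ × ℤ)).tsum_eq
      fun x => ‖latticePoint (upperPair τ) x‖⁻¹ ^ 3
    have hT2 := (Equiv.subRight ((0, 1) : ℤ × ℤ)).tsum_eq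
      fun x => ‖latticePoint (upperPair τ) x‖⁻¹ ^ 3
    have hsum := ((hS.add hS1).add hS2).mul_left 2
    refine (tsum_of_norm_bounded hsum.hasSum fun x => ?_).trans ?_
    · rw [norm_mul, norm_torsionChar, one_mul]
      have h1 : latticePoint (upperPair τ) (0, 1) = 1 := by simp [latticePoint_upperPair]
      simp only [heckeSecondDifference, heckeTerm_zero_left, map_add, map_sub, h1,
        Function.comp_apply, Equiv.coe_addRight, Equiv.subRight_apply]
      exact norm_secondDifference_inv_le _
    · rw [tsum_mul_left, (hS.add hS1).tsum_add hS2, hS.tsum_add hS1]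
      simp only [Function.comp_apply]
      rw [hT1, hT2]
      have := hC τ hτ
      linarith

/-- `g_k` as a modular form of weight one. -/
noncomputable def gModularForm (hN : 0 < N) (k : ℤ) : ModularForm
    ((CongruenceSubgroup.Gamma1 N).map (Matrix.SpecialLinearGroup.mapGL ℝ)) 1 where
  toFun := g N k
  slash_action_eq' := by
    rintro _ ⟨γ, hγ, rfl⟩
    exact slash_g_of_mem_Gamma1 hN k hγ
  holo' := mdifferentiable_g N k
  bdd_at_cusps' := by
    intro c hc
    have : NeZero N := ⟨hN.ne'⟩
    rw [Subgroup.IsArithmetic.isCusp_iff_isCusp_SL2Z] at hc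
    rw [OnePoint.isBoundedAt_iff_forall_SL2Z hc]
    intro γ _
    -- Every slash by `SL(2, ℤ)` is again a dual sum, so one bound at infinity serves all cusps.
    have h : (g N k ∣[(1 : ℤ)] γ) = fun τ =>
        (2 * Real.pi * I)⁻¹ * dualSum N (upperPair τ) (k * γ 1 1) (-(k * γ 1 0)) :=
      funext (slash_g hN k γ)
    rw [h]
    exact (isBoundedAtImInfty_dualSum hN _ _).const_mul_left _

end Cusps

/-! ### The Weierstrass zeta function as a lattice sum. -/

section WeierstrassZeta

/-- The term of the Weierstrass zeta function at the lattice point `w`; at `w = 0` it is `1 / z`. -/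
noncomputable def zetaTerm (z w : ℂ) : ℂ := (z - w)⁻¹ + w⁻¹ + z * (w ^ 2)⁻¹

lemma norm_zetaTerm_le {z w : ℂ} (hw : w ≠ 0) (h : 2 * ‖z‖ ≤ ‖w‖) :
    ‖zetaTerm z w‖ ≤ 2 * ‖z‖ ^ 2 * ‖w‖⁻¹ ^ 3 := by
  have hw0 : 0 < ‖w‖ := norm_pos_iff.2 hw
  have h1 : ‖w‖ / 2 ≤ ‖z - w‖ := by
    have := norm_sub_norm_le w z
    rw [norm_sub_rev] at this
    linarith
  have h2 : z - w ≠ 0 := norm_pos_iff.1 (by linarith)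
  have e : zetaTerm z w = z ^ 2 * (w⁻¹ ^ 2 * (z - w)⁻¹) := by
    rw [zetaTerm]
    field_simp
    ring
  have h3 : ‖z - w‖⁻¹ ≤ 2 * ‖w‖⁻¹ := by
    rw [← one_div, ← div_eq_mul_inv, div_le_div_iff₀ (by linarith) hw0]
    linarith
  rw [e, norm_mul, norm_mul, norm_pow, norm_pow, norm_inv, norm_inv]
  calc _ ≤ ‖z‖ ^ 2 * (‖w‖⁻¹ ^ 2 * (2 * ‖w‖⁻¹)) := by gcongr
    _ = _ := by ring

lemma summable_zetaTerm (P : PeriodPair) (z : ℂ) :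
    Summable fun x => zetaTerm z (latticePoint P x) := by
  refine Summable.of_norm_bounded_eventually
    ((summable_norm_latticePoint_inv_pow P).mul_left (2 * ‖z‖ ^ 2)) ?_
  filter_upwards [(finite_norm_latticePoint_lt P (2 * ‖z‖ + 1)).compl_mem_cofinite] with x hx
  have hx' : 2 * ‖z‖ + 1 ≤ ‖latticePoint P x‖ := not_lt.1 hx
  have := norm_nonneg z
  exact norm_zetaTerm_le (norm_pos_iff.1 (by linarith)) (by linarith)

lemma weierstrassZeta_lattice (P : PeriodPair) (z : ℂ) :
    weierstrassZeta P.lattice z = ∑' x, zetaTerm z (latticePoint P x) := by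
  rw [(summable_zetaTerm P z).tsum_eq_add_tsum_ite 0, weierstrassZeta,
    ← P.latticeEquivProd.symm.toEquiv.tsum_eq]
  congr 1
  · simp [zetaTerm]
  · refine tsum_congr fun x => ?_
    rw [LinearEquiv.coe_toEquiv, latticeEquivProd_symm_coe]
    by_cases hx : x = 0
    · simp [hx]
    · rw [if_neg hx, if_neg (by simpa using hx), zetaTerm]
      simp only [div_eq_mul_inv, one_mul]

lemma mem_lattice_scalePair {P : PeriodPair} {c : ℂ} (hc : c ≠ 0) {z : ℂ} :
    c * z ∈ (scalePair P hc).lattice ↔ z ∈ P.lattice := by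
  simp only [mem_lattice_iff_latticePoint, latticePoint_scalePair, mul_right_inj' hc]

lemma weierstrassZeta_scalePair (P : PeriodPair) {c : ℂ} (hc : c ≠ 0) (z : ℂ) :
    weierstrassZeta (scalePair P hc).lattice (c * z) = c⁻¹ * weierstrassZeta P.lattice z := by
  rw [weierstrassZeta_lattice, weierstrassZeta_lattice, ← tsum_mul_left]
  refine tsum_congr fun x => ?_
  rw [latticePoint_scalePair, zetaTerm, zetaTerm, ← mul_sub, mul_inv, mul_inv, mul_pow, mul_inv]
  field_simp

lemma quasiPeriod_eq {L : Submodule ℤ ℂ} {ω c : ℂ} (hL : ∃ z, z ∉ L)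
    (h : ∀ z ∉ L, weierstrassZeta L (z + ω) = weierstrassZeta L z + c) :
    quasiPeriod L ω = c := by
  have hex : ∃ c : ℂ, ∀ z ∉ L, weierstrassZeta L (z + ω) = weierstrassZeta L z + c := ⟨c, h⟩
  rw [quasiPeriod, dif_pos hex]
  obtain ⟨z, hz⟩ := hL
  have := hex.choose_spec z hz
  rw [h z hz] at this
  exact (add_left_cancel this).symm

end WeierstrassZeta

/-! ### Row expansion of the zeta function on `ℤτ + ℤ`. -/

section UpperZeta

variable (τ : ℍ)

/-- The sum of `(mτ + n)⁻²` over `n`. -/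
noncomputable def rowSquareSum (m : ℤ) : ℂ := ∑' n : ℤ, ((m * τ + n : ℂ) ^ 2)⁻¹

/-- The sum over `m` of the row sums of `(mτ + n)⁻²`, which is the quasi-period of `1`. -/
noncomputable def rowSquareTotal : ℂ := ∑' m : ℤ, rowSquareSum τ m

variable {τ} {z : ℂ}

lemma int_mul_sub_mem_integerComplement (hz : z ∉ (upperPair τ).lattice) (m : ℤ) :
    (m * τ - z : ℂ) ∈ integerComplement := by
  rw [mem_integerComplement_iff]
  rintro ⟨n, hn⟩
  refine hz (mem_lattice_upperPair.2 ⟨m, -n, ?_⟩)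
  push_cast
  linear_combination -hn

lemma tsum_zetaTerm_right (hz : z ∉ (upperPair τ).lattice) (m : ℤ) :
    ∑' n : ℤ, zetaTerm z (latticePoint (upperPair τ) (m, n)) =
      -(Real.pi * cot (Real.pi * (m * τ - z))) + Real.pi * cot (Real.pi * (m * τ))
        + z * rowSquareSum τ m := by
  have hs := (summable_zetaTerm (upperPair τ) z).prod_factor m
  have hq : Summable fun n : ℤ => ((m * τ + n : ℂ) ^ 2)⁻¹ := by
    have := EisensteinSeries.linear_right_summable (τ : ℂ) m (k := 2) le_rfl
    exact_mod_cast this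
  refine tendsto_nhds_unique (tendsto_sum_Icc_of_summable hs) ?_
  refine (((tendsto_sum_Icc_inv_add (int_mul_sub_mem_integerComplement hz m)).neg.add
    (tendsto_sum_Icc_inv_int_mul_add τ m)).add
    ((tendsto_sum_Icc_of_summable hq).const_mul z)).congr fun M => ?_
  rw [Finset.mul_sum, ← Finset.sum_neg_distrib, ← Finset.sum_add_distrib, ← Finset.sum_add_distrib]
  refine Finset.sum_congr rfl fun n _ => ?_
  rw [latticePoint_upperPair, zetaTerm, ← inv_neg]
  congr 3
  ring

lemma add_int_notMem_lattice (hz : z ∉ (upperPair τ).lattice) (d : ℤ) :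
    z + d ∉ (upperPair τ).lattice := by
  intro h
  obtain ⟨m, n, hmn⟩ := mem_lattice_upperPair.1 h
  refine hz (mem_lattice_upperPair.2 ⟨m, n - d, ?_⟩)
  push_cast
  linear_combination hmn

lemma cot_pi_sub_int (w : ℂ) (d : ℤ) : cot (Real.pi * (w - d)) = cot (Real.pi * w) := by
  rw [cot_pi_eq_exp_ratio, cot_pi_eq_exp_ratio]
  have : cexp (2 * Real.pi * I * (w - d)) = cexp (2 * Real.pi * I * w) := by
    rw [mul_sub, mul_comm _ (d : ℂ), Complex.exp_sub, Complex.exp_int_mul_two_pi_mul_I, div_one]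
  rw [this]

lemma summable_row (hz : z ∉ (upperPair τ).lattice) : Summable fun m : ℤ =>
    -(Real.pi * cot (Real.pi * (m * τ - z))) + Real.pi * cot (Real.pi * (m * τ))
      + z * rowSquareSum τ m :=
  (summable_zetaTerm (upperPair τ) z).prod.congr fun m => tsum_zetaTerm_right hz m

lemma weierstrassZeta_eq_tsum_row (hz : z ∉ (upperPair τ).lattice) :
    weierstrassZeta (upperPair τ).lattice z = ∑' m : ℤ,
      (-(Real.pi * cot (Real.pi * (m * τ - z))) + Real.pi * cot (Real.pi * (m * τ))
        + z * rowSquareSum τ m) := by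
  rw [weierstrassZeta_lattice, (summable_zetaTerm (upperPair τ) z).tsum_prod,
    tsum_congr (tsum_zetaTerm_right hz)]

lemma real_notMem_lattice {r : ℝ} (hr : ∀ n : ℤ, (n : ℝ) ≠ r) :
    (r : ℂ) ∉ (upperPair τ).lattice := by
  intro h
  obtain ⟨m, n, hmn⟩ := mem_lattice_upperPair.1 h
  have h1 := congrArg Complex.im hmn
  have h2 := congrArg Complex.re hmn
  simp [τ.im_ne_zero] at h1
  subst h1
  simp at h2
  exact hr n h2

lemma half_notMem_lattice : ((1 / 2 : ℝ) : ℂ) ∉ (upperPair τ).lattice := by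
  refine real_notMem_lattice fun n hn => ?_
  have : ((2 * n : ℤ) : ℝ) = ((1 : ℤ) : ℝ) := by push_cast; linarith
  have := Int.cast_injective this
  omega

/-- The double series of `(mτ + n)⁻²` is not absolutely convergent. But the zeta rows at `1/2` and
`3/2` are summable and share their cotangents, so their difference is exactly the row sum of
squares. -/
lemma summable_rowSquareSum : Summable (rowSquareSum τ) := by
  have h1 := summable_row (half_notMem_lattice (τ := τ))
  have h2 := summable_row (add_int_notMem_lattice (half_notMem_lattice (τ := τ)) 1)
  refine (h2.sub h1).congr fun m => ?_
  rw [← sub_sub (m * τ : ℂ) _ ((1 : ℤ) : ℂ), cot_pi_sub_int]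
  push_cast
  ring

lemma weierstrassZeta_add_int (hz : z ∉ (upperPair τ).lattice) (d : ℤ) :
    weierstrassZeta (upperPair τ).lattice (z + d) =
      weierstrassZeta (upperPair τ).lattice z + d * rowSquareTotal τ := by
  rw [weierstrassZeta_eq_tsum_row hz, weierstrassZeta_eq_tsum_row (add_int_notMem_lattice hz d),
    rowSquareTotal, ← tsum_mul_left,
    ← (summable_row hz).tsum_add (summable_rowSquareSum.mul_left (d : ℂ))]
  refine tsum_congr fun m => ?_
  rw [← sub_sub (m * τ : ℂ) z (d : ℂ), cot_pi_sub_int]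
  ring

/-- Pairing the rows `m` and `-m` cancels `π cot(π m τ)`, and the subtracted multiple of `z` removes
the sums of squares. -/
lemma weierstrassZeta_sub_mul (hz : z ∉ (upperPair τ).lattice) :
    weierstrassZeta (upperPair τ).lattice z - z * rowSquareTotal τ =
      Real.pi * cot (Real.pi * z) + ∑' m : ℕ+,
        (Real.pi * cot (Real.pi * (m * τ + z)) - Real.pi * cot (Real.pi * (m * τ - z))) := by
  have h1 := summable_row hz
  have h2 := (summable_rowSquareSum (τ := τ)).mul_left z
  set c : ℤ → ℂ := fun m =>
    -(Real.pi * cot (Real.pi * (m * τ - z))) + Real.pi * cot (Real.pi * (m * τ)) with hc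
  have h3 : Summable c := (h1.sub h2).congr fun m => by simp only [hc]; ring
  have hp : ∀ f : ℤ → ℂ, Summable f → Summable fun m : ℕ+ => f m := fun f hf =>
    hf.comp_injective fun a b h => PNat.coe_injective (by exact_mod_cast h)
  have h4 : Summable fun m : ℕ+ => c (-(m : ℤ)) :=
    hp (fun m => c (-m)) ((Equiv.neg ℤ).summable_iff.2 h3)
  rw [weierstrassZeta_eq_tsum_row hz, rowSquareTotal, ← tsum_mul_left, ← h1.tsum_sub h2]
  have e : ∑' m : ℤ, (-(Real.pi * cot (Real.pi * (m * τ - z))) + Real.pi * cot (Real.pi * (m * τ))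
      + z * rowSquareSum τ m - z * rowSquareSum τ m) = ∑' m, c m :=
    tsum_congr fun m => by simp only [hc]; ring
  rw [e, tsum_int_eq_zero_add_tsum_pnat h3, add_assoc, ← (hp c h3).tsum_add h4]
  congr 1
  · simp only [hc, Int.cast_zero, zero_mul, zero_sub, mul_neg, cot_neg, neg_neg]
    simp [cot]
  · refine tsum_congr fun m => ?_
    simp only [hc]
    have e1 : (Real.pi * (((-(m : ℤ) : ℤ) : ℂ) * τ - z) : ℂ) = -(Real.pi * (m * τ + z)) := by
      push_cast; ring
    have e2 : (Real.pi * (((-(m : ℤ) : ℤ) : ℂ) * τ) : ℂ) = -(Real.pi * (((m : ℤ) : ℂ) * τ)) := by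
      push_cast; ring
    rw [e1, e2, cot_neg, cot_neg]
    push_cast
    ring

variable {N : ℕ}

lemma div_notMem_lattice (hN : 0 < N) {d : ℤ} (hd : ¬ (N : ℤ) ∣ d) :
    (d / N : ℂ) ∉ (upperPair τ).lattice := by
  have hN' : (N : ℝ) ≠ 0 := by exact_mod_cast hN.ne'
  have h := real_notMem_lattice (τ := τ) (r := (d / N : ℝ)) fun n hn => hd ⟨n, by
    rw [eq_div_iff hN'] at hn
    have : ((n * N : ℤ) : ℝ) = (d : ℝ) := by push_cast; exact hn
    rw [mul_comm]
    exact (Int.cast_injective this).symm⟩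
  simpa using h

lemma weierstrassZeta_div_sub (hN : 0 < N) {d : ℤ} (hd : ¬ (N : ℤ) ∣ d) :
    weierstrassZeta (upperPair τ).lattice (d / N) - d / N * rowSquareTotal τ =
      2 * Real.pi * I * g N d τ := by
  have hw : zetaN N ^ d ≠ 1 := fun h => hd (((isPrimitiveRoot_zetaN hN).zpow_eq_one_iff_dvd d).1 h)
  -- Here the root of unity comes from the shift by `d/N`, so its exponent is the summation index
  -- inside a row; in `dualSum_upperPair` it was the row index. Hence the other order of the Lambert
  -- series.
  rw [weierstrassZeta_sub_mul (div_notMem_lattice hN hd), g, tsum_gTerm_comm,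
    one_div_I_mul_D₀ (norm_zetaN_zpow N d) hw, mul_sub, sub_eq_add_neg, ← mul_neg, ← tsum_neg,
    ← tsum_mul_left]
  congr 1
  · rw [cot_pi_eq_exp_ratio, ← mul_div_assoc (2 * Real.pi * I : ℂ) (d : ℂ), ← zetaN_zpow]
    have h2 : 1 - zetaN N ^ d ≠ 0 := sub_ne_zero.2 (Ne.symm hw)
    field_simp
    rw [I_sq]
    ring
  · refine tsum_congr fun m => ?_
    have hm : (0 : ℝ) < (m * τ : ℂ).im := by
      have hm : (0 : ℝ) < m := by exact_mod_cast m.pos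
      simpa using mul_pos hm τ.im_pos
    have hr : (d / N : ℂ).im = 0 := by
      have : (d / N : ℂ) = ((d / N : ℝ) : ℂ) := by push_cast; rfl
      rw [this, ofReal_im]
    have hexp : ∀ (j : ℤ) (n : ℕ+), cexp (2 * Real.pi * I * (m * τ + j / N)) ^ (n : ℕ) =
        zetaN N ^ (j * n) * nome τ ^ ((n : ℕ) * m) := fun j n => by
      rw [mul_add, Complex.exp_add, mul_pow, ← mul_div_assoc (2 * Real.pi * I : ℂ), ← zetaN_zpow,
        mul_comm, zpow_mul, zpow_natCast, nome, mul_comm (n : ℕ), pow_mul,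
        ← Complex.exp_nat_mul (2 * Real.pi * I * τ)]
      congr 3
      ring
    have hneg : (m * τ - d / N : ℂ) = m * τ + ((-d : ℤ) : ℂ) / N := by push_cast; ring
    have hs : ∀ j : ℤ, Summable fun n : ℕ+ => zetaN N ^ (j * n) * nome τ ^ ((n : ℕ) * m) :=
      fun j => by
        refine Summable.of_norm_bounded
          ((summable_nome_pow_mul τ).prod_symm.prod_factor m).norm fun n => ?_
        rw [norm_mul, norm_zetaN_zpow, one_mul]
        rfl
    rw [pi_mul_cot_pi_eq_tsum_pnat (by rw [add_im, hr, add_zero]; exact hm),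
      pi_mul_cot_pi_eq_tsum_pnat (by rw [sub_im, hr, sub_zero]; exact hm), hneg,
      tsum_congr (hexp d), tsum_congr (hexp (-d))]
    have e : ∑' n : ℕ+, (zetaN N ^ (d * n) - zetaN N ^ (-(d * n))) * nome τ ^ ((n : ℕ) * m) =
        ∑' n : ℕ+, zetaN N ^ (d * n) * nome τ ^ ((n : ℕ) * m)
          - ∑' n : ℕ+, zetaN N ^ (-d * n) * nome τ ^ ((n : ℕ) * m) := by
      rw [← (hs d).tsum_sub (hs (-d))]
      refine tsum_congr fun n => ?_
      rw [sub_mul, neg_mul]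
    rw [e]
    ring

end UpperZeta

/-! ### Katz's form on a general lattice. -/

section KatzForm

variable {N : ℕ}

lemma quasiPeriod_scalePair_upperPair (τ : ℍ) {c : ℂ} (hc : c ≠ 0) (d : ℤ) :
    quasiPeriod (scalePair (upperPair τ) hc).lattice (c * d) = c⁻¹ * (d * rowSquareTotal τ) := by
  refine quasiPeriod_eq ⟨c * ((1 / 2 : ℝ) : ℂ), fun h =>
    half_notMem_lattice ((mem_lattice_scalePair hc).1 h)⟩ fun z hz => ?_
  obtain ⟨w, rfl⟩ : ∃ w, z = c * w := ⟨z / c, by field_simp⟩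
  rw [mem_lattice_scalePair] at hz
  rw [← mul_add, weierstrassZeta_scalePair, weierstrassZeta_scalePair, weierstrassZeta_add_int hz,
    mul_add]

lemma A₁_scalePair_upperPair (hN : 0 < N) (τ : ℍ) {c : ℂ} (hc : c ≠ 0) {d : ℤ}
    (hd : ¬ (N : ℤ) ∣ d) :
    A₁ N (scalePair (upperPair τ) hc).lattice (c * (d / N)) =
      c⁻¹ * (2 * Real.pi * I * g N d τ) := by
  have hN' : (N : ℂ) ≠ 0 := by exact_mod_cast hN.ne'
  have e : (N * (c * (d / N)) : ℂ) = c * d := by field_simp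
  rw [A₁, e, quasiPeriod_scalePair_upperPair, weierstrassZeta_scalePair,
    ← weierstrassZeta_div_sub hN hd]
  ring

lemma G'_scalePair_upperPair (hN : 0 < N) (τ : ℍ) {c : ℂ} (hc : c ≠ 0) (d : ℤ) :
    G' N (scalePair (upperPair τ) hc).lattice (c * (d / N)) =
      c⁻¹ * (2 * Real.pi * I * g N d τ) := by
  have e : (c * (d / N) : ℂ) = latticePoint (scalePair (upperPair τ) hc) (0, d) / N := by
    rw [latticePoint_scalePair, latticePoint_upperPair]
    push_cast
    ring
  rw [e, G'_latticePoint hN _ (wedge_scalePair _ hc (wedge_upperPair τ)), neg_zero,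
    dualSum_scalePair hN, dualSum_upperPair hN]

/-- A period pair with its two periods exchanged. -/
noncomputable def swapPair (P : PeriodPair) : PeriodPair where
  ω₁ := P.ω₂
  ω₂ := P.ω₁
  indep := LinearIndependent.pair_symm_iff.1 P.indep

lemma swapPair_lattice (P : PeriodPair) : (swapPair P).lattice = P.lattice := by
  rw [PeriodPair.lattice, PeriodPair.lattice, Set.pair_comm]
  rfl

lemma exists_wedge_neg (P : PeriodPair) :
    ∃ Q : PeriodPair, Q.lattice = P.lattice ∧ wedge Q.ω₁ Q.ω₂ < 0 := by
  rcases (wedge_ne_zero P).lt_or_gt with h | h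
  · exact ⟨P, rfl, h⟩
  · refine ⟨swapPair P, swapPair_lattice P, ?_⟩
    have : wedge (swapPair P).ω₁ (swapPair P).ω₂ = -wedge P.ω₁ P.ω₂ := by
      simp only [wedge, swapPair]
      ring
    linarith

/-- Write `z = d v` with `v` primitive and complete `v` to a basis `(w, v)` by Bézout; then `τ = w /
v` and `c = v`. The sign in `w` makes the change of basis unimodular of determinant `1`, so the
negative orientation persists and puts `w / v` in the upper half plane. -/
lemma exists_scalePair_lattice_eq {P : PeriodPair} (hP : wedge P.ω₁ P.ω₂ < 0) {z : ℂ}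
    (hz : z ∈ P.lattice) (hz0 : z ≠ 0) :
    ∃ (τ : ℍ) (c : ℂ) (hc : c ≠ 0) (d : ℤ),
      (scalePair (upperPair τ) hc).lattice = P.lattice ∧ z = c * d := by
  obtain ⟨⟨y₁, y₂⟩, rfl⟩ := mem_lattice_iff_latticePoint.1 hz
  have hd : 0 < Int.gcd y₁ y₂ := by
    refine Nat.pos_of_ne_zero fun h => hz0 ?_
    obtain ⟨rfl, rfl⟩ := Int.gcd_eq_zero_iff.1 h
    exact map_zero (latticePoint P)
  obtain ⟨p, q, hpq, h₁, h₂⟩ := Int.exists_gcd_one hd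
  obtain ⟨r, s, hrs⟩ : ∃ r s : ℤ, r * p + s * q = 1 := by
    refine ⟨Int.gcdA p q, Int.gcdB p q, ?_⟩
    have := Int.gcd_eq_gcd_ab p q
    rw [hpq] at this
    push_cast at this
    linarith
  have hrs' : (r * p + s * q : ℂ) = 1 := by exact_mod_cast hrs
  have hrs'' : (r * p + s * q : ℝ) = 1 := by exact_mod_cast hrs
  set v : ℂ := p * P.ω₁ + q * P.ω₂ with hv
  set w : ℂ := s * P.ω₁ - r * P.ω₂ with hw
  have hwv : wedge w v = wedge P.ω₁ P.ω₂ := by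
    have : wedge w v = (r * p + s * q) * wedge P.ω₁ P.ω₂ := by
      simp [wedge, hv, hw]
      ring
    rw [this, hrs'', one_mul]
  have hv0 : v ≠ 0 := fun h => by
    rw [h] at hwv
    simp only [wedge, zero_re, zero_im, mul_zero, sub_zero] at hwv
    simp only [wedge] at hP
    linarith
  have him : 0 < (w / v).im := by
    have : (w / v).im = -wedge w v / normSq v := by
      rw [div_im, wedge]
      ring
    rw [this, hwv]
    exact div_pos (by linarith) (normSq_pos.2 hv0)
  refine ⟨⟨w / v, him⟩, v, hv0, Int.gcd y₁ y₂, ?_, ?_⟩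
  · have key : ∀ x : ℤ × ℤ, latticePoint (scalePair (upperPair ⟨w / v, him⟩) hv0) x =
        latticePoint P (s * x.1 + p * x.2, q * x.2 - r * x.1) := fun x => by
      have e : v * (w / v) = w := by field_simp
      rw [latticePoint_scalePair, latticePoint_upperPair, latticePoint_apply]
      change v * (x.1 * (w / v) + x.2) = _
      rw [mul_add, mul_left_comm, e, hv, hw]
      push_cast
      ring
    ext t
    rw [mem_lattice_iff_latticePoint, mem_lattice_iff_latticePoint]
    constructor
    · rintro ⟨x, rfl⟩
      exact ⟨_, (key x).symm⟩
    · rintro ⟨x, rfl⟩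
      refine ⟨(q * x.1 - p * x.2, r * x.1 + s * x.2), ?_⟩
      rw [key]
      congr 1
      ext
      · change s * (q * x.1 - p * x.2) + p * (r * x.1 + s * x.2) = x.1
        linear_combination x.1 * hrs
      · change q * (r * x.1 + s * x.2) - r * (q * x.1 - p * x.2) = x.2
        linear_combination x.2 * hrs
  · rw [latticePoint_apply, hv]
    have e₁ : (y₁ : ℂ) = p * (Int.gcd y₁ y₂ : ℂ) := by exact_mod_cast h₁
    have e₂ : (y₂ : ℂ) = q * (Int.gcd y₁ y₂ : ℂ) := by exact_mod_cast h₂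
    change (y₁ : ℂ) * P.ω₁ + y₂ * P.ω₂ = _
    rw [Int.cast_natCast]
    linear_combination P.ω₁ * e₁ + P.ω₂ * e₂

lemma A₁_eq_G' (hN : 0 < N) (L : Submodule ℤ ℂ) [DiscreteTopology L] [IsZLattice ℝ L] {u : ℂ}
    (hu : N * u ∈ L) (hu' : u ∉ L) : A₁ N L u = G' N L u := by
  have hN' : (N : ℂ) ≠ 0 := by exact_mod_cast hN.ne'
  obtain ⟨P₀, rfl⟩ := exists_periodPair_lattice_eq L
  obtain ⟨P, hPL, hP⟩ := exists_wedge_neg P₀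
  rw [← hPL] at hu hu' ⊢
  have hu0 : N * u ≠ 0 := mul_ne_zero hN' fun h => hu' (h ▸ zero_mem _)
  obtain ⟨τ, c, hc, d, hL, hd⟩ := exists_scalePair_lattice_eq hP hu hu0
  obtain rfl : u = c * (d / N) := by
    field_simp
    linear_combination hd
  rw [← hL] at hu' ⊢
  rw [G'_scalePair_upperPair hN, A₁_scalePair_upperPair hN]
  -- If `N` divided `d`, then `u` would be an integral multiple of `c` and so lie in the lattice.
  rintro ⟨e, rfl⟩
  refine hu' ((mem_lattice_scalePair hc).2 (mem_lattice_upperPair.2 ⟨0, e, ?_⟩))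
  push_cast
  field_simp
  ring

lemma mem_of_addOrderOf_mk_eq {L : Submodule ℤ ℂ} {u : ℂ}
    (h : addOrderOf (Submodule.Quotient.mk u : ℂ ⧸ L) = N) : N * u ∈ L := by
  have := addOrderOf_nsmul_eq_zero (Submodule.Quotient.mk u : ℂ ⧸ L)
  rw [h, ← Submodule.Quotient.mk_smul, Submodule.Quotient.mk_eq_zero, nsmul_eq_mul] at this
  exact this

lemma notMem_of_addOrderOf_mk_eq (hN : 1 < N) {L : Submodule ℤ ℂ} {u : ℂ}
    (h : addOrderOf (Submodule.Quotient.mk u : ℂ ⧸ L) = N) : u ∉ L := fun hu => by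
  rw [(Submodule.Quotient.mk_eq_zero L).2 hu, addOrderOf_zero] at h
  omega

end KatzForm

end HeckeEisenstein

theorem proposition3p2 (N : ℕ) (hN : 0 < N) :
    -- Hecke's series converges absolutely and has an analytic continuation to `s = 0`
    (∀ (L : Submodule ℤ ℂ) [DiscreteTopology L] [IsZLattice ℝ L] (u : ℂ), N * u ∈ L →
      (∀ s : ℂ, 1 < s.re →
        Summable fun ω : HeckeEisenstein.cosetSet N L u => HeckeEisenstein.heckeTerm s ω) ∧
      ∃ f : ℂ → ℂ, HeckeEisenstein.IsHeckeContinuation N L u f) ∧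
    -- the identity of functions on the upper half plane
    (∀ (k : ℤ) (τ : UpperHalfPlane),
      Summable (HeckeEisenstein.gTerm N k τ) ∧
      1 / (2 * Real.pi * Complex.I) * ∑ a ∈ Finset.range N, ∑ b ∈ Finset.range N,
          HeckeEisenstein.zetaN N ^ (k * a) * HeckeEisenstein.Gab N a b τ
        = HeckeEisenstein.g N k τ) ∧
    -- `g_k` is the value of `G'` at `(2πi(ℤ + ℤτ), 2πi k / N)`
    (∀ (k : ℤ) (τ : UpperHalfPlane),
      HeckeEisenstein.g N k τ = HeckeEisenstein.G' N
        (Submodule.span ℤ {2 * Real.pi * Complex.I, 2 * Real.pi * Complex.I * (τ : ℂ)})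
        (2 * Real.pi * Complex.I * k / N)) ∧
    -- `g_k` is a holomorphic modular form of weight one for `Γ₁(N)`
    (∀ k : ℤ, ∃ f : ModularForm
        ((CongruenceSubgroup.Gamma1 N).map (Matrix.SpecialLinearGroup.mapGL ℝ)) 1,
      ∀ τ : UpperHalfPlane, f τ = HeckeEisenstein.g N k τ) ∧
    -- `A₁ = G'`
    (1 < N → ∀ (L : Submodule ℤ ℂ) [DiscreteTopology L] [IsZLattice ℝ L] (u : ℂ),
      addOrderOf (Submodule.Quotient.mk u : ℂ ⧸ L) = N →
      HeckeEisenstein.A₁ N L u = HeckeEisenstein.G' N L u) := by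
  refine ⟨fun L _ _ u hu => ?_, fun k τ => ⟨HeckeEisenstein.summable_gTerm τ N k, ?_⟩,
    fun k τ => (HeckeEisenstein.G'_two_pi_I hN k τ).symm,
    fun k => ⟨HeckeEisenstein.gModularForm hN k, fun _ => rfl⟩,
    fun hN1 L _ _ u hu => HeckeEisenstein.A₁_eq_G' hN L
      (HeckeEisenstein.mem_of_addOrderOf_mk_eq hu)
      (HeckeEisenstein.notMem_of_addOrderOf_mk_eq hN1 hu)⟩
  · obtain ⟨P, rfl⟩ := HeckeEisenstein.exists_periodPair_lattice_eq L
    obtain ⟨y, rfl⟩ := HeckeEisenstein.exists_latticePoint_div_eq hN hu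
    exact ⟨fun s hs => HeckeEisenstein.summable_heckeTerm_cosetSet P hN y hs,
      HeckeEisenstein.isHeckeContinuation_latticePoint P hN y⟩
  · have := Complex.two_pi_I_ne_zero
    rw [HeckeEisenstein.sum_Gab, HeckeEisenstein.dualSum_upperPair hN]
    field_simp
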